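/- Let $\mathfrak g$ be a finite-dimensional complex semisimple Lie algebra with Cartan subalgebra $\mathfrak h$, simple roots $\alpha_i$ ($i\in I$), simple coroots $\check\alpha_i$ and Chevalley--Serre generators $E_i,F_i$. Put $\mathfrak n=\bigoplus_{\alpha>0}\mathfrak g_\alpha$, $\mathfrak b=\mathfrak h\oplus\mathfrak n$ and $p_{-1}=\sum_{i\in I}F_i$. Let $\nu$ be a permutation of $I$ preserving the Cartan matrix, $T\ge 1$ a multiple of the order of $\nu$, $\omega\in\mathbb C^\times$ a primitive $T$-th root of unity, $\Gamma=\langle\omega\rangle$, and $\varsigma$ the automorphism of $\mathfrak g$ with $\varsigma(E_i)=\omega^{-1}E_{\nu(i)}$ and $\varsigma(F_i)=\omega F_{\nu(i)}$ for all $i\in I$. Let $\mathcal M$ be the field of meromorphic functions on $\mathbb P^1$, with coordinate $t$. The group $\Gamma$ acts on $\mathfrak g$-valued meromorphic functions and differentials, $\omega$ acting by $\varsigma$ on values and by pullback along $t\mapsto\omega^{-1}t$; invariant elements are called cyclotomic. Let $G\subset\operatorname{Aut}\mathfrak g$ be the adjoint group, $N\subset G$ the unipotent subgroup with Lie algebra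 $\mathfrak n$, and $N^{\hat\varsigma}(\mathcal M)$ the group of $\Gamma$-invariant elements of $N(\mathcal M)$, where $\omega$ acts by conjugation by the automorphism $X\otimes f\mapsto\varsigma(X)\otimes f(\omega^{-1}t)$ of $\mathfrak g\otimes\mathcal M$. A cyclotomic $\mathfrak g$-oper is a class of connections $d+p_{-1}\,dt+v$, with $v$ a cyclotomic $\mathfrak b$-valued meromorphic differential, modulo the gauge transformations $d+A\mapsto d-dg\,g^{-1}+\operatorname{Ad}_g A$ by $g\in N^{\hat\varsigma}(\mathcal M)$. It is regular at $x\in\mathbb C$ if it has a representative $d+p_{-1}\,dt+v$ with $v$ regular at $x$. A cyclotomic Miura $\mathfrak g$-oper is a connection $\nabla=d+p_{-1}\,dt+u$ with $u$ a cyclotomic $\mathfrak h$-valued meromorphic differential; its class is the underlying cyclotomic $\mathfrak g$-oper $[\nabla]_\Gamma$. Let $x\in\mathbb C^\times$, and let $\nabla$ be a cyclotomic Miura $\mathfrak g$-oper of the form $$\nabla=d+p_{-1}\,dt+\frac{\check\alpha_i}{t-x}\,dt+r\,dt$$ for some $i\in I$ and some $\mathfrak h$-valued meromorphic function $r$ on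 $\mathbb P^1$ that is regular at $x$. Then $[\nabla]_\Gamma$ is regular at $x$ if and only if $\langle\alpha_i,r(x)\rangle=0$. -/

import Mathlib

open scoped TensorProduct

noncomputable section

/-- The automorphisms of a Lie algebra form a group under composition
(`φ * ψ` is `φ` after `ψ`). -/
instance LieEquiv.instGroupAut {R L : Type*} [CommRing R] [LieRing L] [LieAlgebra R L] :
    Group (L ≃ₗ⁅R⁆ L) where
  mul φ ψ := ψ.trans φ
  one := LieEquiv.refl
  inv φ := φ.symm
  mul_assoc _ _ _ := rfl
  one_mul _ := rfl
  mul_one _ := rfl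
  inv_mul_cancel φ := DFunLike.ext _ _ fun y => φ.symm_apply_apply y

namespace Oper

section Automorphisms

variable {R L : Type*} [CommRing R] [LieRing L] [LieAlgebra R L]

@[simp] theorem aut_mul_apply (φ ψ : L ≃ₗ⁅R⁆ L) (y : L) : (φ * ψ) y = φ (ψ y) := rfl

@[simp] theorem aut_one_apply (y : L) : (1 : L ≃ₗ⁅R⁆ L) y = y := rfl

@[simp] theorem aut_inv_apply_self (φ : L ≃ₗ⁅R⁆ L) (y : L) : φ⁻¹ (φ y) = y :=
  φ.symm_apply_apply y

@[simp] theorem aut_apply_inv_self (φ : L ≃ₗ⁅R⁆ L) (y : L) : φ (φ⁻¹ y) = y :=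
  φ.apply_symm_apply y

end Automorphisms

/-! ### Meromorphic functions on the Riemann sphere

The algebra `𝓜` of meromorphic functions on `ℙ¹`, with coordinate `t = RatFunc.X`, is the field
`RatFunc ℂ` of rational functions. -/

/-- The algebra of meromorphic functions on `ℙ¹` that are regular at the finite point `x`:
the denominator in lowest terms does not vanish at `x`. -/
def regularAt (x : ℂ) : Subalgebra ℂ (RatFunc ℂ) where
  carrier := {f | f.denom.eval x ≠ 0}
  mul_mem' {f g} hf hg h := by
    have := Polynomial.eval_eq_zero_of_dvd_of_eval_eq_zero (RatFunc.denom_mul_dvd f g) h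
    rw [Polynomial.eval_mul] at this
    exact (mul_ne_zero hf hg) this
  add_mem' {f g} hf hg h := by
    have := Polynomial.eval_eq_zero_of_dvd_of_eval_eq_zero (RatFunc.denom_add_dvd f g) h
    rw [Polynomial.eval_mul] at this
    exact (mul_ne_zero hf hg) this
  algebraMap_mem' c := by
    simp [RatFunc.algebraMap_eq_C]

/-- Evaluation at `x` of a function regular at `x`. -/
def evalAt (x : ℂ) : regularAt x →ₐ[ℂ] ℂ where
  toFun f := RatFunc.eval (RingHom.id ℂ) x f.1
  map_one' := RatFunc.eval_one _ _
  map_zero' := RatFunc.eval_zero _ _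
  map_mul' f g := RatFunc.eval_mul _ _ f.2 g.2
  map_add' f g := RatFunc.eval_add _ _ f.2 g.2
  commutes' c := by
    change RatFunc.eval (RingHom.id ℂ) x (algebraMap ℂ (RatFunc ℂ) c) = c
    rw [RatFunc.algebraMap_eq_C, RatFunc.eval_C, RingHom.id_apply]

/-- The quotient rule `(p / q)' = (p' q - p q') / q²`, for `f = p / q` in lowest terms. -/
def ddtFun (f : RatFunc ℂ) : RatFunc ℂ :=
  algebraMap (Polynomial ℂ) (RatFunc ℂ)
      (Polynomial.derivative f.num * f.denom - f.num * Polynomial.derivative f.denom) /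
    algebraMap (Polynomial ℂ) (RatFunc ℂ) f.denom ^ 2

/-- A rational function times its denominator is its numerator. -/
theorem mul_denom (f : RatFunc ℂ) : f * algebraMap (Polynomial ℂ) (RatFunc ℂ) f.denom =
    algebraMap (Polynomial ℂ) (RatFunc ℂ) f.num := by
  have hd : algebraMap (Polynomial ℂ) (RatFunc ℂ) f.denom ≠ 0 :=
    RatFunc.algebraMap_ne_zero f.denom_ne_zero
  exact ((div_eq_iff hd).mp f.num_div_denom).symm

theorem cross_mul_aux {A : Type*} [CommRing A] {n m p q n' m' p' q' : A} (h : n * q = p * m)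
    (h' : n' * q + n * q' = p' * m + p * m') :
    (n' * m - n * m') * q ^ 2 = (p' * q - p * q') * m ^ 2 := by
  linear_combination m * q * h' - (m' * q + m * q') * h

/-- The quotient rule holds for every way to write `f` as a quotient of polynomials. -/
theorem ddtFun_eq {f : RatFunc ℂ} {p q : Polynomial ℂ} (hq : q ≠ 0)
    (hf : f * algebraMap (Polynomial ℂ) (RatFunc ℂ) q = algebraMap (Polynomial ℂ) (RatFunc ℂ) p) :
    ddtFun f =
      algebraMap (Polynomial ℂ) (RatFunc ℂ)
          (Polynomial.derivative p * q - p * Polynomial.derivative q) /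
        algebraMap (Polynomial ℂ) (RatFunc ℂ) q ^ 2 := by
  have hd' : algebraMap (Polynomial ℂ) (RatFunc ℂ) f.denom ≠ 0 :=
    RatFunc.algebraMap_ne_zero f.denom_ne_zero
  have hq' : algebraMap (Polynomial ℂ) (RatFunc ℂ) q ≠ 0 := RatFunc.algebraMap_ne_zero hq
  have hcross : f.num * q = p * f.denom := by
    apply RatFunc.algebraMap_injective ℂ
    rw [map_mul, map_mul, ← hf, ← mul_denom f]
    ring
  rw [ddtFun, div_eq_div_iff (pow_ne_zero 2 hd') (pow_ne_zero 2 hq'), ← map_pow, ← map_pow,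
    ← map_mul, ← map_mul]
  refine congrArg _ (cross_mul_aux hcross ?_)
  have hder := congrArg Polynomial.derivative hcross
  rwa [Polynomial.derivative_mul, Polynomial.derivative_mul] at hder

/-- The derivation `d/dt` of the algebra of meromorphic functions on `ℙ¹`. -/
def ddt : Derivation ℂ (RatFunc ℂ) (RatFunc ℂ) :=
  Derivation.mk'
    { toFun := ddtFun
      map_add' := fun f g => by
        have hf := mul_denom f
        have hg := mul_denom g
        have hdf := RatFunc.algebraMap_ne_zero f.denom_ne_zero
        have hdg := RatFunc.algebraMap_ne_zero g.denom_ne_zero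
        rw [ddtFun_eq (f := f + g) (p := f.num * g.denom + g.num * f.denom)
          (q := f.denom * g.denom) (mul_ne_zero f.denom_ne_zero g.denom_ne_zero)
          (by rw [map_mul, map_add, map_mul, map_mul, ← hf, ← hg]; ring)]
        rw [ddtFun, ddtFun, div_add_div _ _ (pow_ne_zero 2 hdf) (pow_ne_zero 2 hdg),
          div_eq_div_iff (pow_ne_zero 2 (by rw [map_mul]; exact mul_ne_zero hdf hdg))
            (mul_ne_zero (pow_ne_zero 2 hdf) (pow_ne_zero 2 hdg))]
        simp only [Polynomial.derivative_mul, map_add, map_sub, map_mul]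
        ring
      map_smul' := fun c f => by
        have hf := mul_denom f
        rw [RingHom.id_apply, ddtFun_eq (f := c • f) (p := Polynomial.C c * f.num) (q := f.denom)
          f.denom_ne_zero
          (by rw [map_mul, ← hf, RatFunc.algebraMap_C, RatFunc.smul_eq_C_mul]; ring)]
        rw [ddtFun, RatFunc.smul_eq_C_mul]
        simp only [Polynomial.derivative_mul, Polynomial.derivative_C, map_sub, map_mul,
          RatFunc.algebraMap_C, zero_mul, zero_add]
        ring }
    fun f g => by
      have hf := mul_denom f
      have hg := mul_denom g
      have hdf := RatFunc.algebraMap_ne_zero f.denom_ne_zero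
      have hdg := RatFunc.algebraMap_ne_zero g.denom_ne_zero
      change ddtFun (f * g) = f • ddtFun g + g • ddtFun f
      rw [ddtFun_eq (f := f * g) (p := f.num * g.num) (q := f.denom * g.denom)
        (mul_ne_zero f.denom_ne_zero g.denom_ne_zero)
        (by rw [map_mul, map_mul, ← hf, ← hg]; ring)]
      simp only [ddtFun, smul_eq_mul, Polynomial.derivative_mul, map_add, map_sub, map_mul,
        ← hf, ← hg]
      field_simp
      ring

/-- The pullback `f ↦ f ∘ μ_c` along `μ_c : t ↦ c t`, that is, `f(t) ↦ f(c t)`. -/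
def pullback (c : ℂˣ) : RatFunc ℂ →ₐ[ℂ] RatFunc ℂ :=
  RatFunc.mapAlgHom (Polynomial.aeval (Polynomial.C (c : ℂ) * Polynomial.X)) (by
    apply nonZeroDivisors_le_comap_nonZeroDivisors_of_injective
    have hcomp : (Polynomial.aeval (Polynomial.C ((c⁻¹ : ℂˣ) : ℂ) * Polynomial.X)).comp
        (Polynomial.aeval (R := ℂ) (Polynomial.C (c : ℂ) * Polynomial.X)) =
        AlgHom.id ℂ (Polynomial ℂ) := by
      apply Polynomial.algHom_ext
      simp [← mul_assoc, ← Polynomial.C_mul, Polynomial.aeval_C]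
    exact Function.LeftInverse.injective (fun p => DFunLike.congr_fun hcomp p))

/-! ### `𝔤`-valued meromorphic functions and connections

A `𝔤`-valued meromorphic function is an element of `𝔤(𝓜) = 𝓜 ⊗ 𝔤`, a Lie algebra over `𝓜`.
A `𝔤`-valued meromorphic differential `a dt`, and likewise the connection `d + a dt`, is
represented by its coefficient `a`. As `dt` is regular and does not vanish on `ℂ`, the differential
`a dt` is regular at a finite point exactly if `a` is. -/

section Connections

variable {g : Type*} [LieRing g] [LieAlgebra ℂ g]

variable (g) in
/-- The space `𝓜 ⊗ V` of meromorphic functions on `ℙ¹` with values in `V`. -/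
abbrev Mer : Type _ := RatFunc ℂ ⊗[ℂ] g

/-- The inclusion of the `V`-valued functions regular at `x` into all meromorphic ones. -/
def regularIncl (V : Type*) [AddCommGroup V] [Module ℂ V] (x : ℂ) :
    regularAt x ⊗[ℂ] V →ₗ[ℂ] RatFunc ℂ ⊗[ℂ] V :=
  (regularAt x).val.toLinearMap.rTensor V

/-- The value at `x` of a `V`-valued function regular at `x`. -/
def valueAt {V : Type*} [AddCommGroup V] [Module ℂ V] (x : ℂ) (r : regularAt x ⊗[ℂ] V) : V :=
  TensorProduct.lid ℂ V ((evalAt x).toLinearMap.rTensor V r)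

/-- A `𝔤`-valued meromorphic function (or the differential `a dt`) is regular at `x ∈ ℂ`. -/
def IsRegularFunAt (x : ℂ) (a : Mer g) : Prop :=
  a ∈ LinearMap.range (regularIncl g x)

/-- The derivative `∂ = d/dt` of `𝔤`-valued meromorphic functions. -/
def del : Mer g →ₗ[ℂ] Mer g := ddt.toLinearMap.rTensor g

/-- `X dt` is the logarithmic derivative `dφ φ⁻¹` of the meromorphic function `φ` with values in the
automorphism group of `𝔤`: the derivative of `φ` is the operator `y ↦ ∂(φ y) - φ(∂ y)`, and it has
to be equal to `ad X` after `φ`. -/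
def IsLogDeriv (φ : Mer g ≃ₗ⁅RatFunc ℂ⁆ Mer g) (X : Mer g) : Prop :=
  ∀ y : Mer g, del (φ y) - φ (del y) = ⁅X, φ y⁆

/-- The gauge transformation by `φ` takes the connection `d + A dt` to `d + A' dt`, that is,
`A' dt = Ad_φ (A dt) - dφ φ⁻¹`. -/
def IsGauge (φ : Mer g ≃ₗ⁅RatFunc ℂ⁆ Mer g) (A A' : Mer g) : Prop :=
  ∃ X : Mer g, IsLogDeriv φ X ∧ A' = φ A - X

theorem isGauge_one (A : Mer g) : IsGauge 1 A A :=
  ⟨0, fun y => by simp, by simp⟩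

theorem IsGauge.inv {φ : Mer g ≃ₗ⁅RatFunc ℂ⁆ Mer g} {A A' : Mer g} (h : IsGauge φ A A') :
    IsGauge φ⁻¹ A' A := by
  obtain ⟨X, hX, rfl⟩ := h
  refine ⟨-(φ⁻¹ X), fun y => ?_, by simp⟩
  have h1 := congrArg (φ⁻¹ : Mer g ≃ₗ⁅RatFunc ℂ⁆ Mer g) (hX (φ⁻¹ y))
  rw [map_sub, LieEquiv.map_lie] at h1
  simp only [aut_apply_inv_self, aut_inv_apply_self] at h1
  rw [neg_lie, ← h1]
  abel

theorem IsGauge.mul {φ ψ : Mer g ≃ₗ⁅RatFunc ℂ⁆ Mer g} {A A' A'' : Mer g}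
    (h : IsGauge φ A A') (h' : IsGauge ψ A' A'') : IsGauge (ψ * φ) A A'' := by
  obtain ⟨X, hX, rfl⟩ := h
  obtain ⟨Y, hY, rfl⟩ := h'
  refine ⟨Y + ψ X, fun y => ?_, by simp; abel⟩
  have h1 := congrArg ψ (hX y)
  rw [map_sub, LieEquiv.map_lie] at h1
  rw [aut_mul_apply, aut_mul_apply, add_lie, ← hY, ← h1]
  abel

end Connections

/-! ### The Lie-theoretic and cyclotomic data -/

section Opers

open LieAlgebra LieAlgebra.IsKilling

variable {g : Type*} [LieRing g] [LieAlgebra ℂ g] [FiniteDimensional ℂ g]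
  [LieAlgebra.IsSemisimple ℂ g] {H : LieSubalgebra ℂ g} [H.IsCartanSubalgebra]

/-- A choice of Chevalley-Serre generators `E_i ∈ 𝔤_{α_i}`, `F_i ∈ 𝔤_{-α_i}` with
`[E_i, F_i] = α_i^∨`, where `i` runs through the simple roots. -/
structure ChevalleyGenerators (b : (rootSystem H).Base) where
  /-- The raising generators. -/
  E : b.support → g
  /-- The lowering generators. -/
  F : b.support → g
  E_mem (i : b.support) : E i ∈ rootSpace H (i.1.1 : H → ℂ)
  F_mem (i : b.support) : F i ∈ rootSpace H (-(i.1.1 : H → ℂ))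
  lie_E_F (i : b.support) : ⁅E i, F i⁆ = ((rootSystem H).coroot i.1 : g)

/-- Chevalley-Serre generators, a diagram automorphism `ν`, a multiple `T ≥ 1` of its order, a
primitive `T`-th root of unity `ω`, and the automorphism `ς = Ad_{ω^{-ρ^∨}} ∘ ν` of `𝔤`, which is
determined by its values `ς(E_i) = ω⁻¹ E_{ν(i)}` and `ς(F_i) = ω F_{ν(i)}`. -/
structure CyclotomicDatum (b : (rootSystem H).Base) extends ChevalleyGenerators b where
  /-- The diagram automorphism. -/
  ν : Equiv.Perm b.support
  cartanMatrix_ν (i j : b.support) : b.cartanMatrix (ν i) (ν j) = b.cartanMatrix i j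
  /-- The order of the cyclic group. -/
  T : ℕ
  T_pos : 1 ≤ T
  orderOf_ν_dvd : orderOf ν ∣ T
  /-- The primitive root of unity. -/
  ω : ℂˣ
  isPrimitiveRoot_ω : IsPrimitiveRoot ω T
  /-- The automorphism of the Lie algebra. -/
  ς : g ≃ₗ⁅ℂ⁆ g
  ς_E (i : b.support) : ς (E i) = ((ω⁻¹ : ℂˣ) : ℂ) • E (ν i)
  ς_F (i : b.support) : ς (F i) = (ω : ℂ) • F (ν i)

/-- The nilpotent subalgebra `𝔫`, the sum of the root spaces of the positive roots. -/
def nilpotentPart (b : (rootSystem H).Base) : Submodule ℂ g :=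
  ⨆ α : H.root, ⨆ _ : b.IsPos α, (rootSpace H (α.1 : H → ℂ)).toSubmodule

/-- The Borel subalgebra `𝔟 = 𝔥 ⊕ 𝔫`. -/
def borel (b : (rootSystem H).Base) : Submodule ℂ g := H.toSubmodule ⊔ nilpotentPart b

/-- The group `N(𝓜)`, inside the automorphisms of the `𝓜`-Lie algebra `𝔤(𝓜)`: it is generated by
the root subgroups `G_α(𝓜) = {exp (ad (f E_α)) | f ∈ 𝓜}` of the positive roots `α`. -/
def unipotentGroup (b : (rootSystem H).Base) : Subgroup (Mer g ≃ₗ⁅RatFunc ℂ⁆ Mer g) :=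
  Subgroup.closure {φ | ∃ α : H.root, b.IsPos α ∧ ∃ e ∈ rootSpace H (α.1 : H → ℂ),
    ∃ f : RatFunc ℂ, ∀ y : Mer g,
      φ y = IsNilpotent.exp (LieAlgebra.ad (RatFunc ℂ) (Mer g) (f ⊗ₜ[ℂ] e)) y}

/-- The inclusion of the `𝔥`-valued meromorphic functions into the `𝔤`-valued ones. -/
def cartanIncl (H : LieSubalgebra ℂ g) : RatFunc ℂ ⊗[ℂ] H →ₗ[ℂ] Mer g :=
  H.toSubmodule.subtype.lTensor (RatFunc ℂ)

namespace CyclotomicDatum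

variable {b : (rootSystem H).Base} (D : CyclotomicDatum b)

/-- The regular nilpotent element `p₋₁ = ∑ F_i`. -/
def pMinus : g := ∑ i, D.F i

/-- The action `X ⊗ f ↦ ς(X) ⊗ f(ω⁻¹ t)` of the generator of the cyclic group on `𝔤`-valued
meromorphic functions. -/
def twist : Mer g →ₗ[ℂ] Mer g :=
  TensorProduct.map (pullback D.ω⁻¹).toLinearMap (D.ς : g →ₗ⁅ℂ⁆ g).toLinearMap

/-- The same action on `𝔤`-valued differentials `a dt`; since `dt` is pulled back to `ω⁻¹ dt`, the
coefficient is multiplied by `ω⁻¹`. -/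
def twistForm (a : Mer g) : Mer g := ((D.ω⁻¹ : ℂˣ) : ℂ) • D.twist a

/-- The group of invariants in `N(𝓜)` of the cyclic group, whose generator acts by conjugation. -/
def cyclotomicUnipotentGroup : Subgroup (Mer g ≃ₗ⁅RatFunc ℂ⁆ Mer g) where
  carrier := {φ | φ ∈ unipotentGroup b ∧ ∀ y, D.twist (φ y) = φ (D.twist y)}
  one_mem' := ⟨one_mem _, fun y => rfl⟩
  mul_mem' {φ ψ} hφ hψ := ⟨mul_mem hφ.1 hψ.1, fun y => by
    rw [aut_mul_apply, aut_mul_apply, hφ.2, hψ.2]⟩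
  inv_mem' {φ} hφ := ⟨inv_mem hφ.1, fun y => by
    have h := congrArg (φ⁻¹ : Mer g ≃ₗ⁅RatFunc ℂ⁆ Mer g) (hφ.2 (φ⁻¹ y))
    rw [aut_apply_inv_self, aut_inv_apply_self] at h
    exact h.symm⟩

/-- A cyclotomic connection `d + p₋₁ dt + v dt` with `v dt` an invariant `𝔟`-valued meromorphic
differential. -/
structure OperConnection where
  /-- The coefficient of the `𝔟`-valued differential. -/
  v : Mer g
  v_mem : v ∈ (borel b).baseChange (RatFunc ℂ)
  v_cyclotomic : D.twistForm v = v

variable {D} in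
/-- The coefficient `p₋₁ + v` of the connection `d + p₋₁ dt + v dt`. -/
def OperConnection.coeff (N : D.OperConnection) : Mer g := 1 ⊗ₜ[ℂ] D.pMinus + N.v

variable {D} in
/-- The connection `d + p₋₁ dt + v dt` is regular at `x`. -/
def OperConnection.IsRegularAt (N : D.OperConnection) (x : ℂ) : Prop := IsRegularFunAt x N.v

/-- Equivalence under gauge transformations by cyclotomic elements of `N(𝓜)`. -/
instance operSetoid : Setoid D.OperConnection where
  r := fun N N' => ∃ φ ∈ D.cyclotomicUnipotentGroup, IsGauge φ N.coeff N'.coeff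
  iseqv :=
    { refl := fun _ => ⟨1, one_mem _, isGauge_one _⟩
      symm := fun ⟨φ, hφ, h⟩ => ⟨φ⁻¹, inv_mem hφ, h.inv⟩
      trans := fun ⟨φ, hφ, h⟩ ⟨ψ, hψ, h'⟩ => ⟨ψ * φ, mul_mem hψ hφ, h.mul h'⟩ }

/-- Cyclotomic `𝔤`-opers: gauge equivalence classes of cyclotomic connections
`d + p₋₁ dt + v dt`. -/
def CyclotomicOper : Type _ := Quotient D.operSetoid

variable {D} in
/-- A cyclotomic oper is regular at `x` if it has a representative that is regular at `x`. -/
def CyclotomicOper.IsRegularAt (c : D.CyclotomicOper) (x : ℂ) : Prop :=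
  ∃ N : D.OperConnection, Quotient.mk D.operSetoid N = c ∧ N.IsRegularAt x

/-- A cyclotomic Miura oper `d + p₋₁ dt + u dt` with `u dt` an invariant `𝔥`-valued meromorphic
differential. -/
structure CyclotomicMiuraOper where
  /-- The coefficient of the `𝔥`-valued differential. -/
  u : RatFunc ℂ ⊗[ℂ] H
  u_cyclotomic : D.twistForm (cartanIncl H u) = cartanIncl H u

variable {D} in
/-- A cyclotomic Miura oper as a cyclotomic connection of the form `d + p₋₁ dt + v dt`. -/
def CyclotomicMiuraOper.toOperConnection (M : D.CyclotomicMiuraOper) : D.OperConnection where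
  v := cartanIncl H M.u
  v_mem := by
    induction M.u using TensorProduct.induction_on with
    | zero => rw [map_zero]; exact zero_mem _
    | tmul f h =>
      exact Submodule.tmul_mem_baseChange_of_mem f
        ((le_sup_left : H.toSubmodule ≤ borel b) h.2)
    | add y z hy hz => rw [map_add]; exact add_mem hy hz
  v_cyclotomic := M.u_cyclotomic

variable {D} in
/-- The cyclotomic oper underlying a cyclotomic Miura oper. -/
def CyclotomicMiuraOper.underlyingOper (M : D.CyclotomicMiuraOper) : D.CyclotomicOper :=
  Quotient.mk D.operSetoid M.toOperConnection

end CyclotomicDatum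

end Opers

end Oper

end

noncomputable section

namespace Oper

/-! ### The height grading defined by `ρ^∨`, and its filtration of `𝔤(𝓜)` -/

section HeightFiltration

open LieAlgebra LieAlgebra.IsKilling

variable {g : Type*} [LieRing g] [LieAlgebra ℂ g] [FiniteDimensional ℂ g]
  [LieAlgebra.IsSemisimple ℂ g] {H : LieSubalgebra ℂ g} [H.IsCartanSubalgebra]

/-! Write `w = 1/(t - x)` and `κ` for the Killing form.

Necessity rests on a quadratic gauge invariant. On connections with coefficient `A ∈ p₋₁ + 𝔟(𝓜)`,
the function `κ(A, A) + 2 ∂κ(ρ^∨, A)` does not change under `N(𝓜)` (`quadraticInvariant_gauge`), and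
it is regular at `x` when `A` is. For the Miura connection, put `c = κ(ρ^∨, α_i^∨) ≠ 0`. The double
poles `κ(w α_i^∨, w α_i^∨) = 2c w²` and `2 ∂(c w) = -2c w²` cancel, and the only other singular term
is `2c w ⟨α_i, r⟩`. Regularity of the oper therefore forces `⟨α_i, r(x)⟩ = 0`.

For sufficiency, gauging by `exp(ad a)` with `a = -w E_i` leaves only the possible pole `w ⟨α_i, r⟩
E_i` (`local_gauge_eq`), which is regular under the hypothesis. This element need not be cyclotomic,
so `a` is replaced by the orbit sum `n` of `f E_i` under `Γ`. Since `x ≠ 0`, the points of the orbit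
of `x` are distinct, and Bézout's identity gives a rational `f` that agrees with `-w` to high order
at `x` and whose other translates vanish there to high order (`exists_approximation`). Then `exp(ad
n) = R exp(ad a)`, where `R` and `R⁻¹` preserve the functions regular at `x`. The logarithmic
derivative of `R` is then regular (`isRegular_logDeriv`), so gauging by `R` keeps the connection
regular.

The summands of `n` need not commute, so two facts about `N(𝓜)` are needed: it contains every
automorphism that is unipotent for the height filtration (`mem_unipotentGroup_of_isUnipotent`), and
each of its elements has a logarithmic derivative in `𝔫(𝓜)` (`unipotent_of_mem_unipotentGroup`).
That derivative is unique because `𝔤` has trivial centre. -/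

theorem exists_apply_eq_height (b : (rootSystem H).Base) :
    ∃ ρ : H, ∀ α : H.root, α.1 ρ = (b.height α : ℂ) := by
  -- The functional on the dual of `𝔥` with value 1 on every simple root; by reflexivity it is
  -- evaluation at a vector of `𝔥`.
  let c : Module.Dual ℂ (Module.Dual ℂ H) := b.toWeightBasis.constr ℂ fun _ => (1 : ℂ)
  refine ⟨(Module.evalEquiv ℂ H).symm c, fun α => ?_⟩
  have h1 : ∀ j : H.root, j ∈ b.support →
      (rootSystem H).root j ((Module.evalEquiv ℂ H).symm c) = 1 := by
    intro j hj
    rw [Module.apply_evalEquiv_symm_apply, ← b.toWeightBasis_apply ⟨j, hj⟩, Module.Basis.constr_basis]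
  obtain ⟨f, hf, -, hsum⟩ := b.exists_root_eq_sum_int α
  change (rootSystem H).root α _ = _
  rw [b.height_eq_sum hsum, hsum]
  simp only [LinearMap.sum_apply, LinearMap.smul_apply, Int.cast_sum]
  refine Finset.sum_congr rfl fun j hj => ?_
  rw [h1 j hj]
  simp

/-- The element `ρ^∨` of the Cartan subalgebra on which a root takes its height as value. -/
def rhoCheck (b : (rootSystem H).Base) : H := (exists_apply_eq_height b).choose

theorem root_apply_rhoCheck (b : (rootSystem H).Base) (α : H.root) :
    α.1 (rhoCheck b) = (b.height α : ℂ) := (exists_apply_eq_height b).choose_spec α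

/-- `e` belongs to a root space (or to the Cartan subalgebra) of height `j`. -/
def IsHomogeneous (b : (rootSystem H).Base) (j : ℤ) (e : g) : Prop :=
  ∃ χ : H → ℂ, χ (rhoCheck b) = j ∧ e ∈ rootSpace H χ

variable {b : (rootSystem H).Base}

theorem IsHomogeneous.lie {i j : ℤ} {e f : g} (he : IsHomogeneous b i e)
    (hf : IsHomogeneous b j f) : IsHomogeneous b (i + j) ⁅e, f⁆ := by
  obtain ⟨χ, h, he⟩ := he
  obtain ⟨ψ, h', hf⟩ := hf
  exact ⟨χ + ψ, by simp [h, h'], lie_mem_genWeightSpace_of_mem_genWeightSpace he hf⟩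

theorem IsHomogeneous.lie_rhoCheck {j : ℤ} {e : g} (he : IsHomogeneous b j e) :
    ⁅(rhoCheck b : g), e⁆ = (j : ℂ) • e := by
  obtain ⟨χ, h, he⟩ := he
  rw [← h, ← lie_eq_smul_of_mem_rootSpace he]
  rfl

/-- A nonzero homogeneous vector lies in the Cartan subalgebra or in a root space. -/
theorem IsHomogeneous.cases {j : ℤ} {e : g} (he : IsHomogeneous b j e) :
    e = 0 ∨ (j = 0 ∧ e ∈ H) ∨
      ∃ α : H.root, b.height α = j ∧ e ∈ rootSpace H (α.1 : H → ℂ) := by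
  obtain ⟨χ, h, he⟩ := he
  by_cases h0 : e = 0
  · exact Or.inl h0
  right
  by_cases hχ : χ = 0
  · left
    subst hχ
    rw [rootSpace_zero_eq] at he
    exact ⟨by simpa using h.symm, he⟩
  right
  have hb : rootSpace H χ ≠ ⊥ := by
    intro hb
    rw [hb] at he
    exact h0 he
  let α : LieModule.Weight ℂ H g := ⟨χ, hb⟩
  have hα : α.IsNonZero := fun h => hχ h
  refine ⟨⟨α, by simpa [LieSubalgebra.root] using hα⟩, ?_, he⟩
  have := root_apply_rhoCheck b ⟨α, by simpa [LieSubalgebra.root] using hα⟩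
  have h2 : α (rhoCheck b) = j := h
  rw [h2] at this
  exact_mod_cast this.symm

theorem isHomogeneous_cartan (y : H) : IsHomogeneous b 0 (y : g) :=
  ⟨0, by simp, by rw [rootSpace_zero_eq]; exact y.2⟩

theorem isHomogeneous_root {α : H.root} {e : g} (he : e ∈ rootSpace H (α.1 : H → ℂ)) :
    IsHomogeneous b (b.height α) e :=
  ⟨α.1, root_apply_rhoCheck b α, he⟩

variable (b) in
theorem exists_height_bound :
    ∃ N : ℕ, ∀ (j : ℤ) (e : g), IsHomogeneous b j e → e ≠ 0 → -N ≤ j ∧ j ≤ N := by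
  refine ⟨Finset.univ.sup fun α : H.root => (b.height α).natAbs, fun j e he h0 => ?_⟩
  rcases he.cases with h | ⟨rfl, -⟩ | ⟨α, rfl, -⟩
  · exact absurd h h0
  · omega
  · have := Finset.le_sup (f := fun α : H.root => (b.height α).natAbs) (Finset.mem_univ α)
    omega

variable (b) in
/-- A bound for the absolute values of the heights of the roots. -/
def heightBound : ℕ := (exists_height_bound b).choose

theorem IsHomogeneous.bound {j : ℤ} {e : g} (he : IsHomogeneous b j e) (h0 : e ≠ 0) :
    -heightBound b ≤ j ∧ j ≤ heightBound b :=
  (exists_height_bound b).choose_spec j e he h0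

variable (b) in
/-- The filtration of `𝔤(𝓜)` by height. -/
def filtration (k : ℤ) : Submodule (RatFunc ℂ) (Mer g) :=
  Submodule.span (RatFunc ℂ)
    {y | ∃ (f : RatFunc ℂ) (e : g) (j : ℤ), k ≤ j ∧ IsHomogeneous b j e ∧ y = f ⊗ₜ[ℂ] e}

theorem tmul_mem_filtration {k j : ℤ} (hkj : k ≤ j) (f : RatFunc ℂ) {e : g}
    (he : IsHomogeneous b j e) : f ⊗ₜ[ℂ] e ∈ filtration b k :=
  Submodule.subset_span ⟨f, e, j, hkj, he, rfl⟩

/-- Scalars from `𝓜` are absorbed into the first tensor factor, so no case for scalar multiples is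
needed. -/
theorem filtration_induction {k : ℤ} {p : Mer g → Prop} (h0 : p 0)
    (hadd : ∀ y z, y ∈ filtration b k → z ∈ filtration b k → p y → p z → p (y + z))
    (h : ∀ (f : RatFunc ℂ) (e : g) (j : ℤ), k ≤ j → IsHomogeneous b j e → p (f ⊗ₜ[ℂ] e))
    {y : Mer g} (hy : y ∈ filtration b k) : p y := by
  have key : y ∈ filtration b k ∧ ∀ c : RatFunc ℂ, p (c • y) := by
    refine Submodule.span_induction (p := fun y _ => y ∈ filtration b k ∧ ∀ c : RatFunc ℂ, p (c • y))
      ?_ ?_ ?_ ?_ hy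
    · rintro _ ⟨f, e, j, hj, he, rfl⟩
      exact ⟨tmul_mem_filtration hj f he, fun c => by
        rw [TensorProduct.smul_tmul']; exact h _ e j hj he⟩
    · exact ⟨zero_mem _, fun c => by rwa [smul_zero]⟩
    · rintro y z - - ⟨hy, hy'⟩ ⟨hz, hz'⟩
      exact ⟨add_mem hy hz, fun c => by
        rw [smul_add]
        exact hadd _ _ (Submodule.smul_mem _ _ hy) (Submodule.smul_mem _ _ hz) (hy' c) (hz' c)⟩
    · rintro a y - ⟨hy, hy'⟩
      exact ⟨Submodule.smul_mem _ _ hy, fun c => by rw [smul_smul]; exact hy' _⟩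
  simpa using key.2 1

theorem filtration_anti {k l : ℤ} (h : k ≤ l) : filtration b l ≤ filtration b k :=
  Submodule.span_mono fun _ ⟨f, e, j, hj, he⟩ => ⟨f, e, j, h.trans hj, he⟩

theorem filtration_eq_bot {k : ℤ} (hk : heightBound b < k) : filtration b k = ⊥ := by
  rw [eq_bot_iff]
  intro y hy
  refine filtration_induction (p := fun y => y ∈ (⊥ : Submodule (RatFunc ℂ) (Mer g))) (zero_mem _)
    (fun _ _ _ _ => add_mem) ?_ hy
  intro f e j hj he
  by_cases h0 : e = 0
  · rw [h0, TensorProduct.tmul_zero]; exact zero_mem _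
  · have := he.bound h0
    omega

/-- `𝔤` is the sum of its weight spaces, and no nonzero vector is homogeneous of height below
`-heightBound b`. -/
theorem filtration_eq_top {k : ℤ} (hk : k ≤ -heightBound b) : filtration b k = ⊤ := by
  rw [eq_top_iff]
  rintro y -
  induction y using TensorProduct.induction_on with
  | zero => exact zero_mem _
  | add y z hy hz => exact add_mem hy hz
  | tmul f e =>
    have he : e ∈ (⨆ χ : LieModule.Weight ℂ H g, rootSpace H (χ : H → ℂ)) := by
      rw [LieModule.iSup_genWeightSpace_eq_top']; trivial
    rw [← LieSubmodule.mem_toSubmodule, LieSubmodule.iSup_toSubmodule] at he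
    induction he using Submodule.iSup_induction' with
    | zero => rw [TensorProduct.tmul_zero]; exact zero_mem _
    | add e e' _ _ h h' => rw [TensorProduct.tmul_add]; exact add_mem h h'
    | mem χ e he =>
      by_cases h0 : e = 0
      · rw [h0, TensorProduct.tmul_zero]; exact zero_mem _
      have hom : ∃ j, IsHomogeneous b j e := by
        by_cases hχ : χ.IsZero
        · exact ⟨0, χ, by simp [hχ.eq], he⟩
        · exact ⟨_, isHomogeneous_root (α := ⟨χ, by simpa [LieSubalgebra.root] using hχ⟩) he⟩
      obtain ⟨j, hj⟩ := hom
      exact tmul_mem_filtration (hk.trans (hj.bound h0).1) f hj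

theorem lie_mem_filtration {i j : ℤ} {y z : Mer g} (hy : y ∈ filtration b i)
    (hz : z ∈ filtration b j) : ⁅y, z⁆ ∈ filtration b (i + j) := by
  refine filtration_induction (p := fun y => ⁅y, z⁆ ∈ filtration b (i + j)) ?_ ?_ ?_ hy
  · rw [zero_lie]; exact zero_mem _
  · intro y y' _ _ h h'
    rw [add_lie]; exact add_mem h h'
  intro f e k hk he
  refine filtration_induction (p := fun z => ⁅f ⊗ₜ[ℂ] e, z⁆ ∈ filtration b (i + j)) ?_ ?_ ?_ hz
  · rw [lie_zero]; exact zero_mem _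
  · intro y y' _ _ h h'
    rw [lie_add]; exact add_mem h h'
  intro f' e' k' hk' he'
  rw [LieAlgebra.ExtendScalars.bracket_tmul]
  exact tmul_mem_filtration (by omega) _ (he.lie he')

/-- `ad ρ^∨` acts on the graded pieces of the height filtration as the degree. -/
theorem lie_rhoCheck_sub_mem {k : ℤ} {y : Mer g} (hy : y ∈ filtration b k) :
    ⁅(1 : RatFunc ℂ) ⊗ₜ[ℂ] (rhoCheck b : g), y⁆ - (k : RatFunc ℂ) • y ∈ filtration b (k + 1) := by
  refine filtration_induction (p := fun y => ⁅(1 : RatFunc ℂ) ⊗ₜ[ℂ] (rhoCheck b : g), y⁆ -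
    (k : RatFunc ℂ) • y ∈ filtration b (k + 1)) ?_ ?_ ?_ hy
  · simp
  · intro y z _ _ h h'
    rw [lie_add, smul_add, add_sub_add_comm]; exact add_mem h h'
  intro f e j hj he
  rw [LieAlgebra.ExtendScalars.bracket_tmul, he.lie_rhoCheck, one_mul, TensorProduct.tmul_smul,
    show (j : ℂ) • f ⊗ₜ[ℂ] e = (j : RatFunc ℂ) • f ⊗ₜ[ℂ] e by
      rw [Int.cast_smul_eq_zsmul, Int.cast_smul_eq_zsmul], ← sub_smul]
  rcases hj.eq_or_lt with rfl | hj
  · simp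
  · exact Submodule.smul_mem _ _ (tmul_mem_filtration (by omega) f he)

theorem tmul_mem_filtration_of_mem_nilpotentPart (f : RatFunc ℂ) {e : g}
    (he : e ∈ nilpotentPart b) : f ⊗ₜ[ℂ] e ∈ filtration b 1 := by
  have hle : nilpotentPart b ≤
      ((filtration b 1).restrictScalars ℂ).comap (TensorProduct.mk ℂ (RatFunc ℂ) g f) := by
    refine iSup_le fun α => iSup_le fun hα e he => ?_
    exact tmul_mem_filtration (show 1 ≤ b.height α from hα) f (isHomogeneous_root he)
  exact hle he

theorem mem_nilpotentPart_of_isHomogeneous {j : ℤ} (hj : 1 ≤ j) {e : g}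
    (he : IsHomogeneous b j e) : e ∈ nilpotentPart b := by
  rcases he.cases with h | ⟨rfl, -⟩ | ⟨α, rfl, h⟩
  · rw [h]; exact zero_mem _
  · omega
  · exact Submodule.mem_iSup_of_mem α
      (Submodule.mem_iSup_of_mem (show b.IsPos α from hj) h)

/-- No root has height 0, so nonnegative height singles out `𝔥` and the positive root spaces. -/
theorem borel_baseChange_eq : (borel b).baseChange (RatFunc ℂ) = filtration b 0 := by
  apply le_antisymm
  · rw [Submodule.baseChange_eq_span, Submodule.span_le]
    rintro _ ⟨e, he, rfl⟩
    obtain ⟨y, hy, z, hz, rfl⟩ := Submodule.mem_sup.mp he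
    change (1 : RatFunc ℂ) ⊗ₜ[ℂ] (y + z) ∈ filtration b 0
    rw [TensorProduct.tmul_add]
    exact add_mem (tmul_mem_filtration le_rfl 1 (isHomogeneous_cartan ⟨y, hy⟩))
      (filtration_anti zero_le_one (tmul_mem_filtration_of_mem_nilpotentPart 1 hz))
  · refine Submodule.span_le.mpr ?_
    rintro _ ⟨f, e, j, hj, he, rfl⟩
    refine Submodule.tmul_mem_baseChange_of_mem f ?_
    rcases he.cases with h | ⟨rfl, h⟩ | ⟨α, rfl, h⟩
    · rw [h]; exact zero_mem _
    · exact (le_sup_left : H.toSubmodule ≤ borel b) h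
    · refine (le_sup_right : nilpotentPart b ≤ borel b)
        (mem_nilpotentPart_of_isHomogeneous ?_ (isHomogeneous_root h))
      have := b.height_ne_zero α
      omega

end HeightFiltration

/-! ### Derivations of `𝔤(𝓜)` and logarithmic derivatives -/

section Derivative

variable {g : Type*} [LieRing g] [LieAlgebra ℂ g]

/-- The coefficients `1/i!` of the exponential of a nilpotent derivation are rational scalars. -/
instance : LieAlgebra ℚ (Mer g) where
  lie_smul q y z := map_rat_smul (LieAlgebra.ad (RatFunc ℂ) (Mer g) y) q z

theorem rat_smul_eq_complex_smul (q : ℚ) (y : Mer g) : q • y = (q : ℂ) • y := by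
  have := ratCast_smul_eq ℂ ℚ q y
  exact this.symm

@[simp] theorem del_tmul (f : RatFunc ℂ) (e : g) : del (f ⊗ₜ[ℂ] e) = ddt f ⊗ₜ[ℂ] e := rfl

theorem del_lie (y z : Mer g) : del ⁅y, z⁆ = ⁅del y, z⁆ + ⁅y, del z⁆ := by
  induction y using TensorProduct.induction_on with
  | zero => simp
  | add y y' hy hy' =>
    simp only [add_lie, map_add, hy, hy']
    abel
  | tmul f e =>
    induction z using TensorProduct.induction_on with
    | zero => simp
    | add y y' hy hy' =>
      simp only [lie_add, map_add, hy, hy']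
      abel
    | tmul f' e' =>
      simp only [LieAlgebra.ExtendScalars.bracket_tmul, del_tmul, Derivation.leibniz,
        TensorProduct.add_tmul, smul_eq_mul]
      rw [add_comm, mul_comm f']

theorem IsLogDeriv.mul {φ ψ : Mer g ≃ₗ⁅RatFunc ℂ⁆ Mer g} {X Y : Mer g}
    (hX : IsLogDeriv φ X) (hY : IsLogDeriv ψ Y) : IsLogDeriv (ψ * φ) (Y + ψ X) := by
  intro y
  have h1 := congrArg ψ (hX y)
  rw [map_sub, LieEquiv.map_lie] at h1
  rw [aut_mul_apply, aut_mul_apply, add_lie, ← hY, ← h1]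
  abel

theorem IsLogDeriv.inv {φ : Mer g ≃ₗ⁅RatFunc ℂ⁆ Mer g} {X : Mer g} (hX : IsLogDeriv φ X) :
    IsLogDeriv φ⁻¹ (-(φ⁻¹ X)) := by
  intro y
  have h1 := congrArg (φ⁻¹ : Mer g ≃ₗ⁅RatFunc ℂ⁆ Mer g) (hX (φ⁻¹ y))
  rw [map_sub, LieEquiv.map_lie] at h1
  simp only [aut_apply_inv_self, aut_inv_apply_self] at h1
  rw [neg_lie, ← h1]
  abel

end Derivative

/-! ### Exponentials and the unipotent group `N(𝓜)` -/

section Exponentials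

open LieAlgebra LieAlgebra.IsKilling

variable {g : Type*} [LieRing g] [LieAlgebra ℂ g] [FiniteDimensional ℂ g]
  [LieAlgebra.IsSemisimple ℂ g] {H : LieSubalgebra ℂ g} [H.IsCartanSubalgebra]
  {b : (rootSystem H).Base}

theorem ad_pow_mem_filtration {k m : ℤ} {n y : Mer g} (hn : n ∈ filtration b k)
    (hy : y ∈ filtration b m) (i : ℕ) :
    (ad (RatFunc ℂ) (Mer g) n ^ i) y ∈ filtration b (m + i * k) := by
  induction i with
  | zero => simpa using hy
  | succ i ih =>
    rw [pow_succ', Module.End.mul_apply, ad_apply]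
    have := lie_mem_filtration hn ih
    convert this using 2
    push_cast
    ring

variable (b) in
/-- An exponent that annihilates all `ad n` with `n` of positive height. -/
def nilpotencyBound : ℕ := 2 * heightBound b + 1

/-- Each application of `ad n` raises the height by at least 1, and all heights lie between
`-heightBound b` and `heightBound b`. -/
theorem ad_pow_eq_zero {n : Mer g} (hn : n ∈ filtration b 1) :
    ad (RatFunc ℂ) (Mer g) n ^ nilpotencyBound b = 0 := by
  refine LinearMap.ext fun y => ?_
  have hy : y ∈ filtration b (-heightBound b) := by rw [filtration_eq_top le_rfl]; trivial
  have := ad_pow_mem_filtration hn hy (nilpotencyBound b)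
  rw [filtration_eq_bot (by unfold nilpotencyBound; push_cast; omega)] at this
  simpa using this

theorem isNilpotent_derivation_ad {n : Mer g} (hn : n ∈ filtration b 1) :
    IsNilpotent (LieDerivation.ad (RatFunc ℂ) (Mer g) n).toLinearMap := by
  have h : (LieDerivation.ad (RatFunc ℂ) (Mer g) n).toLinearMap = ad (RatFunc ℂ) (Mer g) n :=
    LinearMap.ext fun y => by simp
  rw [h]
  exact ⟨_, ad_pow_eq_zero hn⟩

/-- The automorphism `exp (ad n)` of `𝔤(𝓜)` for `n ∈ 𝔫(𝓜)`. -/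
def expAd (n : Mer g) (hn : n ∈ filtration b 1) : Mer g ≃ₗ⁅RatFunc ℂ⁆ Mer g :=
  LieDerivation.exp (LieDerivation.ad (RatFunc ℂ) (Mer g) n) (isNilpotent_derivation_ad hn)

theorem expAd_apply {n : Mer g} (hn : n ∈ filtration b 1) (y : Mer g) :
    expAd n hn y = IsNilpotent.exp (ad (RatFunc ℂ) (Mer g) n) y := by
  rw [expAd, LieDerivation.exp_map_apply]
  congr 2
  exact LinearMap.ext fun y => by simp

theorem expAd_apply_eq_sum {n : Mer g} (hn : n ∈ filtration b 1) {y : Mer g} {k : ℕ}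
    (hk : (ad (RatFunc ℂ) (Mer g) n ^ k) y = 0) :
    expAd n hn y =
      ∑ i ∈ Finset.range k, (i.factorial : ℂ)⁻¹ • (ad (RatFunc ℂ) (Mer g) n ^ i) y := by
  rw [expAd_apply]
  refine (IsNilpotent.exp_smul_eq_sum (a := ad (RatFunc ℂ) (Mer g) n) (m := y) hk
    ⟨_, ad_pow_eq_zero hn⟩).trans (Finset.sum_congr rfl fun i _ => ?_)
  rw [rat_smul_eq_complex_smul]
  push_cast
  rfl

theorem expAd_inv_apply {n : Mer g} (hn : n ∈ filtration b 1) (y : Mer g) :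
    (expAd n hn)⁻¹ y = expAd (-n) (neg_mem hn) y := by
  have h : (LieDerivation.ad (RatFunc ℂ) (Mer g) n).toLinearMap = ad (RatFunc ℂ) (Mer g) n :=
    LinearMap.ext fun y => by simp
  rw [expAd_apply, map_neg, ← h]
  -- The inverse of the exponential of a derivation is by construction the exponential of its
  -- negative.
  rfl

/-- `φ` raises the height by at least `k`, up to the identity. -/
def IsUnipotentOfLevel (b : (rootSystem H).Base) (k : ℤ) (φ : Mer g ≃ₗ⁅RatFunc ℂ⁆ Mer g) : Prop :=
  ∀ (m : ℤ) (y : Mer g), y ∈ filtration b m → φ y - y ∈ filtration b (m + k)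

theorem expAd_isUnipotentOfLevel {n : Mer g} (hn : n ∈ filtration b 1) {k : ℤ} (hk : 1 ≤ k)
    (hnk : n ∈ filtration b k) : IsUnipotentOfLevel b k (expAd n hn) := by
  intro m y hy
  have h0 : (ad (RatFunc ℂ) (Mer g) n ^ nilpotencyBound b) y = 0 := by
    rw [ad_pow_eq_zero hn]; rfl
  rw [expAd_apply_eq_sum hn h0, nilpotencyBound, Finset.sum_range_succ']
  simp only [Nat.factorial_zero, Nat.cast_one, inv_one, one_smul, pow_zero, Module.End.one_apply,
    add_sub_cancel_right]
  refine Submodule.sum_mem _ fun i _ => Submodule.smul_of_tower_mem _ _ ?_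
  refine filtration_anti ?_ (ad_pow_mem_filtration hnk hy (i + 1))
  push_cast
  nlinarith [Int.natCast_nonneg i]

theorem IsUnipotentOfLevel.mono {φ : Mer g ≃ₗ⁅RatFunc ℂ⁆ Mer g} {k l : ℤ}
    (h : IsUnipotentOfLevel b l φ) (hkl : k ≤ l) : IsUnipotentOfLevel b k φ :=
  fun m y hy => filtration_anti (by omega) (h m y hy)

theorem IsUnipotentOfLevel.apply_mem {φ : Mer g ≃ₗ⁅RatFunc ℂ⁆ Mer g} {k m : ℤ} (hk : 0 ≤ k)
    (h : IsUnipotentOfLevel b k φ) {y : Mer g} (hy : y ∈ filtration b m) :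
    φ y ∈ filtration b m := by
  have := add_mem (filtration_anti (by omega) (h m y hy)) hy
  simpa using this

theorem IsUnipotentOfLevel.mul {φ ψ : Mer g ≃ₗ⁅RatFunc ℂ⁆ Mer g} {k : ℤ} (hk : 0 ≤ k)
    (hφ : IsUnipotentOfLevel b k φ) (hψ : IsUnipotentOfLevel b k ψ) :
    IsUnipotentOfLevel b k (φ * ψ) := by
  intro m y hy
  have := add_mem (hφ m _ (hψ.apply_mem hk hy)) (hψ m y hy)
  simpa using this

/-- As `y = φ y - (φ y - y)`, membership of `y` in one step below `m` implies membership in the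
next; the climb starts at the bottom, where the filtration is everything. This controls `φ⁻¹`
without a formula for it. -/
theorem IsUnipotentOfLevel.mem_of_apply_mem {φ : Mer g ≃ₗ⁅RatFunc ℂ⁆ Mer g} {k m : ℤ} (hk : 1 ≤ k)
    (h : IsUnipotentOfLevel b k φ) {y : Mer g} (hy : φ y ∈ filtration b m) :
    y ∈ filtration b m := by
  have key : ∀ i : ℕ, -heightBound b + (i : ℤ) ≤ m → y ∈ filtration b (-heightBound b + i) := by
    intro i
    induction i with
    | zero =>
      intro _
      rw [filtration_eq_top (by simp)]
      trivial
    | succ i ih =>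
      intro hi
      push_cast at hi ⊢
      have h1 := h _ y (ih (by omega))
      have h2 := sub_mem (filtration_anti hi hy)
        (filtration_anti (b := b) (by omega : -(heightBound b : ℤ) + (i + 1) ≤ _) h1)
      simpa using h2
  rcases le_or_gt m (-heightBound b) with hm | hm
  · rw [filtration_eq_top hm]; trivial
  · have := key (m + heightBound b).toNat (by omega)
    convert this using 2
    omega

theorem IsUnipotentOfLevel.inv {φ : Mer g ≃ₗ⁅RatFunc ℂ⁆ Mer g} {k : ℤ} (hk : 1 ≤ k)
    (h : IsUnipotentOfLevel b k φ) : IsUnipotentOfLevel b k φ⁻¹ := by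
  intro m y hy
  have h1 : φ⁻¹ y ∈ filtration b m := h.mem_of_apply_mem hk (by simpa using hy)
  have h2 := neg_mem (h m _ h1)
  simpa using h2

theorem expAd_tmul_mem_unipotentGroup {f : RatFunc ℂ} {e : g} {j : ℤ} (hj : 1 ≤ j)
    (he : IsHomogeneous b j e) :
    expAd (f ⊗ₜ[ℂ] e) (tmul_mem_filtration hj f he) ∈ unipotentGroup b := by
  rcases he.cases with h0 | ⟨rfl, -⟩ | ⟨α, rfl, h⟩
  · subst h0
    convert one_mem (unipotentGroup b)
    refine DFunLike.ext _ _ fun y => ?_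
    rw [expAd_apply]
    simp
    rfl
  · omega
  · exact Subgroup.subset_closure ⟨α, hj, e, h, f, fun y => expAd_apply _ y⟩

/-- In general `d(exp n) exp(-n)` is a series of iterated brackets of `n` with `∂n`; commutation
leaves only its first term. Concretely, `[∂, (ad n)^i] = i (ad n)^(i-1) ad(∂n)`, and these sum to
`ad(∂n)` after `exp(ad n)`. -/
theorem isLogDeriv_expAd {n : Mer g} (hn : n ∈ filtration b 1) (h0 : ⁅n, del n⁆ = 0) :
    IsLogDeriv (expAd n hn) (del n) := by
  have hcomm : ∀ (i : ℕ) (y : Mer g), ⁅del n, (ad (RatFunc ℂ) (Mer g) n ^ i) y⁆ =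
      (ad (RatFunc ℂ) (Mer g) n ^ i) ⁅del n, y⁆ := by
    intro i
    induction i with
    | zero => intro y; rfl
    | succ i ih =>
      intro y
      rw [pow_succ, Module.End.mul_apply, Module.End.mul_apply, ih, ad_apply, ad_apply,
        leibniz_lie n, h0, zero_lie, zero_add]
  have hpow : ∀ (i : ℕ) (y : Mer g), del ((ad (RatFunc ℂ) (Mer g) n ^ i) y) -
      (ad (RatFunc ℂ) (Mer g) n ^ i) (del y) =
      (i : ℂ) • (ad (RatFunc ℂ) (Mer g) n ^ (i - 1)) ⁅del n, y⁆ := by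
    intro i
    induction i with
    | zero => intro y; simp
    | succ i ih =>
      intro y
      have h1 := ih ⁅n, y⁆
      rw [del_lie, map_add] at h1
      rw [pow_succ, Module.End.mul_apply, Module.End.mul_apply, ad_apply, ad_apply,
        Nat.add_sub_cancel, Nat.cast_add, Nat.cast_one, add_smul, one_smul]
      have h2 : (i : ℂ) • (ad (RatFunc ℂ) (Mer g) n ^ (i - 1)) ⁅del n, ⁅n, y⁆⁆ =
          (i : ℂ) • (ad (RatFunc ℂ) (Mer g) n ^ i) ⁅del n, y⁆ := by
        cases i with
        | zero => simp
        | succ i =>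
          rw [Nat.add_sub_cancel, pow_succ, Module.End.mul_apply, ad_apply, leibniz_lie n, h0,
            zero_lie, zero_add]
      rw [h2] at h1
      rw [← h1]
      abel
  intro y
  have hz : ∀ y : Mer g, (ad (RatFunc ℂ) (Mer g) n ^ (nilpotencyBound b)) y = 0 := fun y => by
    rw [ad_pow_eq_zero hn]; rfl
  -- One term beyond the nilpotency bound: the factor `i` in `hpow` kills the term `i = 0`, and the
  -- index shift then leaves exactly `nilpotencyBound b` terms.
  have hz' : ∀ y : Mer g, (ad (RatFunc ℂ) (Mer g) n ^ (nilpotencyBound b + 1)) y = 0 := fun y => by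
    rw [pow_succ, ad_pow_eq_zero hn, zero_mul]; rfl
  rw [expAd_apply_eq_sum hn (hz' y), expAd_apply_eq_sum hn (hz' (del y)), map_sum,
    ← Finset.sum_sub_distrib]
  simp only [map_smul, ← smul_sub, hpow]
  rw [Finset.sum_range_succ', ← expAd_apply_eq_sum hn (hz' y), expAd_apply_eq_sum hn (hz y),
    lie_sum]
  simp only [Nat.cast_zero, zero_smul, smul_zero, add_zero, Nat.add_sub_cancel]
  refine Finset.sum_congr rfl fun i _ => ?_
  rw [lie_smul, hcomm, smul_smul, Nat.factorial_succ]
  congr 1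
  push_cast
  field_simp

/-- The elements of `N(𝓜)` are unipotent and have a logarithmic derivative in `𝔫(𝓜)`. -/
theorem unipotent_of_mem_unipotentGroup {φ : Mer g ≃ₗ⁅RatFunc ℂ⁆ Mer g}
    (hφ : φ ∈ unipotentGroup b) :
    IsUnipotentOfLevel b 1 φ ∧ ∃ X ∈ filtration b 1, IsLogDeriv φ X := by
  induction hφ using Subgroup.closure_induction with
  | mem φ h =>
    obtain ⟨α, hα, e, he, f, h⟩ := h
    have hn := tmul_mem_filtration (show 1 ≤ b.height α from hα) f (isHomogeneous_root he)
    have hφ : φ = expAd (f ⊗ₜ[ℂ] e) hn := by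
      refine DFunLike.ext _ _ fun y => ?_
      rw [h, expAd_apply]
    rw [hφ]
    refine ⟨expAd_isUnipotentOfLevel hn le_rfl hn, _,
      tmul_mem_filtration (show 1 ≤ b.height α from hα) (ddt f) (isHomogeneous_root he),
      isLogDeriv_expAd hn ?_⟩
    rw [del_tmul, LieAlgebra.ExtendScalars.bracket_tmul, lie_self, TensorProduct.tmul_zero]
  | one =>
    exact ⟨fun m y _ => by change y - y ∈ _; rw [sub_self]; exact zero_mem _, 0, zero_mem _,
      fun y => by change del y - del y = ⁅0, y⁆; rw [sub_self, zero_lie]⟩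
  | mul φ ψ _ _ hφ hψ =>
    obtain ⟨hφ, X, hX, hX'⟩ := hφ
    obtain ⟨hψ, Y, hY, hY'⟩ := hψ
    exact ⟨hφ.mul zero_le_one hψ, X + φ Y, add_mem hX (hφ.apply_mem zero_le_one hY), hY'.mul hX'⟩
  | inv φ _ hφ =>
    obtain ⟨hφ, X, hX, hX'⟩ := hφ
    exact ⟨hφ.inv le_rfl, _, neg_mem ((hφ.inv le_rfl).apply_mem zero_le_one hX), hX'.inv⟩

/-- Such a `φ` commutes with `ad ρ^∨`. For `y` of height `j`, the difference `φ y - y` is thus an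
eigenvector of `ad ρ^∨` for `j`, but lies in heights above `j`, where only larger eigenvalues occur.
Hence it vanishes. -/
theorem eq_one_of_apply_rhoCheck_eq {φ : Mer g ≃ₗ⁅RatFunc ℂ⁆ Mer g}
    (hφ : IsUnipotentOfLevel b 1 φ)
    (h : φ (1 ⊗ₜ[ℂ] (rhoCheck b : g)) = 1 ⊗ₜ[ℂ] (rhoCheck b : g)) : φ = 1 := by
  set ρ : Mer g := 1 ⊗ₜ[ℂ] (rhoCheck b : g) with hρ
  refine DFunLike.ext _ _ fun y => ?_
  have hy : y ∈ filtration b (-heightBound b) := by rw [filtration_eq_top le_rfl]; trivial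
  refine filtration_induction (p := fun y => φ y = (1 : Mer g ≃ₗ⁅RatFunc ℂ⁆ Mer g) y) ?_ ?_ ?_ hy
  · simp
  · intro y z _ _ hy hz
    rw [map_add, map_add, hy, hz]
  intro f e j _ he
  rw [aut_one_apply, ← sub_eq_zero]
  set d := φ (f ⊗ₜ[ℂ] e) - f ⊗ₜ[ℂ] e with hd
  have he' : ⁅ρ, f ⊗ₜ[ℂ] e⁆ = (j : RatFunc ℂ) • (f ⊗ₜ[ℂ] e) := by
    rw [hρ, LieAlgebra.ExtendScalars.bracket_tmul, he.lie_rhoCheck, one_mul,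
      TensorProduct.tmul_smul, Int.cast_smul_eq_zsmul, Int.cast_smul_eq_zsmul]
  have hd1 : ⁅ρ, d⁆ = (j : RatFunc ℂ) • d := by
    have h1 := congrArg φ he'
    rw [LieEquiv.map_lie, h, map_smul] at h1
    rw [hd, lie_sub, h1, he', smul_sub]
  have key : ∀ i : ℕ, d ∈ filtration b (j + 1 + i) := by
    intro i
    induction i with
    | zero => simpa using hφ j _ (tmul_mem_filtration le_rfl f he)
    | succ i ih =>
      have h1 := lie_rhoCheck_sub_mem ih
      rw [← hρ, hd1, ← sub_smul] at h1
      -- The eigenvalue `j` differs from the degree `j + 1 + i` of the leading term, so that term is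
      -- zero and `d` moves up one step.
      have h2 : (j : RatFunc ℂ) - ((j + 1 + i : ℤ) : RatFunc ℂ) ≠ 0 := by
        rw [← Int.cast_sub, Int.cast_ne_zero]
        omega
      rw [Submodule.smul_mem_iff _ h2] at h1
      push_cast
      rwa [← add_assoc]
  have := key (heightBound b + (-j).toNat)
  rwa [filtration_eq_bot (by push_cast; omega), Submodule.mem_bot] at this

/-- Elements of `N(𝓜)` move `ρ^∨` by a prescribed leading term. -/
theorem exists_unipotent_apply_rhoCheck {k : ℤ} (hk : 1 ≤ k) {w : Mer g}
    (hw : w ∈ filtration b k) :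
    ∃ ψ ∈ unipotentGroup b, IsUnipotentOfLevel b k ψ ∧
      ψ (1 ⊗ₜ[ℂ] (rhoCheck b : g)) - 1 ⊗ₜ[ℂ] (rhoCheck b : g) - w ∈ filtration b (k + 1) := by
  set ρ : Mer g := 1 ⊗ₜ[ℂ] (rhoCheck b : g) with hρ
  refine filtration_induction (p := fun w => ∃ ψ ∈ unipotentGroup b, IsUnipotentOfLevel b k ψ ∧
      ψ ρ - ρ - w ∈ filtration b (k + 1)) ?_ ?_ ?_ hw
  · exact ⟨1, one_mem _, fun m y _ => by simp, by simp⟩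
  -- The product `ψ ψ'` moves `ρ^∨` by `w + w'` to leading order, since `ψ` fixes `w'` modulo height
  -- `2k ≥ k + 1`.
  · rintro w w' - hw' ⟨ψ, hψ, hψk, h⟩ ⟨ψ', hψ', hψk', h'⟩
    refine ⟨ψ * ψ', mul_mem hψ hψ', hψk.mul (by omega) hψk', ?_⟩
    have h1 := (hψk.mono hk).apply_mem zero_le_one h'
    have h2 := (hψk.mono hk) k w' hw'
    have := add_mem h (add_mem h1 h2)
    convert this using 1
    simp only [aut_mul_apply, map_sub]
    abel
  · intro f e j hj he
    have hj0 : (j : RatFunc ℂ) ≠ 0 := Int.cast_ne_zero.mpr (by omega)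
    -- Since `[ρ^∨, e] = j e`, this coefficient makes the first-order term `f e`; the second-order
    -- term is a multiple of `[e, e] = 0`.
    have hn := tmul_mem_filtration (hk.trans hj) (-((j : RatFunc ℂ)⁻¹ * f)) he
    refine ⟨_, expAd_tmul_mem_unipotentGroup (hk.trans hj) he,
      expAd_isUnipotentOfLevel hn hk (tmul_mem_filtration hj _ he), ?_⟩
    have h1 : ⁅(-((j : RatFunc ℂ)⁻¹ * f)) ⊗ₜ[ℂ] e, ρ⁆ = f ⊗ₜ[ℂ] e := by
      rw [← lie_skew, hρ, LieAlgebra.ExtendScalars.bracket_tmul, he.lie_rhoCheck,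
        TensorProduct.tmul_smul, Int.cast_smul_eq_zsmul, ← Int.cast_smul_eq_zsmul (RatFunc ℂ),
        TensorProduct.smul_tmul', ← TensorProduct.neg_tmul]
      congr 1
      rw [smul_eq_mul]
      field_simp
    have h2 : (ad (RatFunc ℂ) (Mer g) ((-((j : RatFunc ℂ)⁻¹ * f)) ⊗ₜ[ℂ] e) ^ 2) ρ = 0 := by
      rw [pow_two, Module.End.mul_apply, ad_apply, ad_apply, h1,
        LieAlgebra.ExtendScalars.bracket_tmul, lie_self, TensorProduct.tmul_zero]
    rw [expAd_apply_eq_sum hn h2]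
    simp [Finset.sum_range_succ, h1]

/-- Every unipotent automorphism of `𝔤(𝓜)` belongs to `N(𝓜)`. -/
theorem mem_unipotentGroup_of_isUnipotent {φ : Mer g ≃ₗ⁅RatFunc ℂ⁆ Mer g}
    (hφ : IsUnipotentOfLevel b 1 φ) : φ ∈ unipotentGroup b := by
  set ρ : Mer g := 1 ⊗ₜ[ℂ] (rhoCheck b : g) with hρ
  have hρ0 : ρ ∈ filtration b 0 := tmul_mem_filtration le_rfl 1 (isHomogeneous_cartan _)
  -- Induction on the number `i` of filtration steps left: left multiplication by some `ψ ∈ N(𝓜)`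
  -- cancels the leading term of `φ ρ - ρ`. When nothing is left, `φ` fixes `ρ^∨` and is the
  -- identity.
  have key : ∀ (i : ℕ) (k : ℤ), 1 ≤ k → heightBound b < k + i →
      ∀ φ : Mer g ≃ₗ⁅RatFunc ℂ⁆ Mer g, IsUnipotentOfLevel b 1 φ → φ ρ - ρ ∈ filtration b k →
        φ ∈ unipotentGroup b := by
    intro i
    induction i with
    | zero =>
      intro k hk hi φ hφ h
      rw [filtration_eq_bot (by simpa using hi), Submodule.mem_bot, sub_eq_zero] at h
      rw [eq_one_of_apply_rhoCheck_eq hφ h]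
      exact one_mem _
    | succ i ih =>
      intro k hk hi φ hφ h
      obtain ⟨ψ, hψ, hψk, hψρ⟩ := exists_unipotent_apply_rhoCheck hk (neg_mem h)
      have h1 : ψ * φ ∈ unipotentGroup b := by
        refine ih (k + 1) (by omega) (by push_cast at hi; omega) _
          ((hψk.mono hk).mul zero_le_one hφ) ?_
        have := add_mem hψρ ((hψk.mono hk) k _ h)
        convert this using 1
        simp only [aut_mul_apply, map_sub]
        abel
      rw [← inv_mul_cancel_left ψ φ]
      exact mul_mem (inv_mem hψ) h1
  refine key (heightBound b) 1 le_rfl (by omega) φ hφ ?_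
  simpa using hφ 0 ρ hρ0

end Exponentials

/-! ### Scalar functions regular at `x` -/

section RegularFunctions

variable {x : ℂ}

theorem div_mem_regularAt (p : Polynomial ℂ) {q : Polynomial ℂ} (hq : q.eval x ≠ 0) :
    algebraMap (Polynomial ℂ) (RatFunc ℂ) p / algebraMap (Polynomial ℂ) (RatFunc ℂ) q ∈
      regularAt x := fun h =>
  hq (Polynomial.eval_eq_zero_of_dvd_of_eval_eq_zero (RatFunc.denom_div_dvd p q) h)

theorem algebraMap_mem_regularAt (p : Polynomial ℂ) :
    algebraMap (Polynomial ℂ) (RatFunc ℂ) p ∈ regularAt x := by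
  simpa using div_mem_regularAt (x := x) p (q := 1) (by simp)

theorem ddt_mem_regularAt {f : RatFunc ℂ} (hf : f ∈ regularAt x) : ddt f ∈ regularAt x := by
  change ddtFun f ∈ _
  rw [ddtFun, ← map_pow]
  refine div_mem_regularAt _ ?_
  rw [Polynomial.eval_pow]
  exact pow_ne_zero 2 hf

variable (x) in
/-- The local parameter `t - x`. -/
abbrev localParam : RatFunc ℂ := RatFunc.X - RatFunc.C x

theorem localParam_eq_algebraMap : localParam x =
    algebraMap (Polynomial ℂ) (RatFunc ℂ) (Polynomial.X - Polynomial.C x) := by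
  rw [map_sub, RatFunc.algebraMap_X, RatFunc.algebraMap_C]

theorem localParam_ne_zero : localParam x ≠ 0 := by
  rw [localParam_eq_algebraMap]
  exact RatFunc.algebraMap_ne_zero (Polynomial.X_sub_C_ne_zero x)

theorem localParam_mem_regularAt : localParam x ∈ regularAt x := by
  rw [localParam_eq_algebraMap]
  exact algebraMap_mem_regularAt _

theorem ddt_algebraMap (p : Polynomial ℂ) :
    ddt (algebraMap (Polynomial ℂ) (RatFunc ℂ) p) =
      algebraMap (Polynomial ℂ) (RatFunc ℂ) (Polynomial.derivative p) := by
  change ddtFun _ = _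
  rw [ddtFun_eq (p := p) (q := 1) one_ne_zero (by simp)]
  simp

theorem ddt_inv_localParam : ddt (localParam x)⁻¹ = -(localParam x)⁻¹ ^ 2 := by
  have h1 : ddt (localParam x) = 1 := by
    rw [localParam_eq_algebraMap, ddt_algebraMap]
    simp
  rw [Derivation.leibniz_inv, h1]
  simp

/-- The factor theorem for the numerator. Both directions of the main theorem meet the vanishing of
`⟨α_i, r⟩` at `x` in this form. -/
theorem evalAt_eq_zero_iff (f : regularAt x) :
    evalAt x f = 0 ↔ (localParam x)⁻¹ * f.1 ∈ regularAt x := by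
  constructor
  · intro h
    have hd : f.1.denom.eval x ≠ 0 := f.2
    have h1 : f.1.num.eval x = 0 := by
      have h2 : RatFunc.eval (RingHom.id ℂ) x f.1 = 0 := h
      rw [RatFunc.eval, div_eq_zero_iff] at h2
      exact h2.resolve_right hd
    obtain ⟨q, hq⟩ := Polynomial.dvd_iff_isRoot.mpr h1
    have h3 : (localParam x)⁻¹ * f.1 = algebraMap (Polynomial ℂ) (RatFunc ℂ) q /
        algebraMap (Polynomial ℂ) (RatFunc ℂ) f.1.denom := by
      conv_lhs => rw [← RatFunc.num_div_denom f.1, hq, map_mul, ← localParam_eq_algebraMap]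
      rw [mul_div_assoc, inv_mul_cancel_left₀ localParam_ne_zero]
    rw [h3]
    exact div_mem_regularAt q hd
  · intro h
    have h1 : f = ⟨localParam x, localParam_mem_regularAt⟩ * ⟨_, h⟩ := by
      apply Subtype.ext
      exact (mul_inv_cancel_left₀ localParam_ne_zero _).symm
    have h2 : evalAt x ⟨localParam x, localParam_mem_regularAt⟩ = 0 := by
      change RatFunc.eval (RingHom.id ℂ) x (localParam x) = 0
      rw [localParam_eq_algebraMap, RatFunc.eval_algebraMap]
      simp
    rw [h1, map_mul, h2, zero_mul]

end RegularFunctions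

/-! ### `𝔤`-valued functions filtered by order of vanishing at `x` -/

section Lattices

variable {g : Type*} [LieRing g] [LieAlgebra ℂ g] {x : ℂ}

theorem tmul_mem_range_regularIncl {f : RatFunc ℂ} (hf : f ∈ regularAt x) (e : g) :
    f ⊗ₜ[ℂ] e ∈ LinearMap.range (regularIncl g x) :=
  ⟨(⟨f, hf⟩ : regularAt x) ⊗ₜ[ℂ] e, rfl⟩

theorem regular_induction {p : Mer g → Prop} (h0 : p 0)
    (hadd : ∀ y z, p y → p z → p (y + z))
    (h : ∀ (f : RatFunc ℂ) (e : g), f ∈ regularAt x → p (f ⊗ₜ[ℂ] e))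
    {y : Mer g} (hy : y ∈ LinearMap.range (regularIncl g x)) : p y := by
  obtain ⟨z, rfl⟩ := hy
  induction z using TensorProduct.induction_on with
  | zero => rwa [map_zero]
  | tmul f e => exact h f.1 e f.2
  | add y z hy hz => rw [map_add]; exact hadd _ _ hy hz

theorem smul_mem_range_regularIncl {f : RatFunc ℂ} (hf : f ∈ regularAt x) {a : Mer g}
    (ha : a ∈ LinearMap.range (regularIncl g x)) :
    f • a ∈ LinearMap.range (regularIncl g x) := by
  refine regular_induction (p := fun a => f • a ∈ LinearMap.range (regularIncl g x)) ?_ ?_ ?_ ha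
  · rw [smul_zero]; exact zero_mem _
  · intro y z hy hz
    rw [smul_add]; exact add_mem hy hz
  · intro f' e hf'
    exact tmul_mem_range_regularIncl (mul_mem hf hf') e

theorem lie_mem_range_regularIncl {a c : Mer g} (ha : a ∈ LinearMap.range (regularIncl g x))
    (hc : c ∈ LinearMap.range (regularIncl g x)) :
    ⁅a, c⁆ ∈ LinearMap.range (regularIncl g x) := by
  refine regular_induction (p := fun a => ⁅a, c⁆ ∈ LinearMap.range (regularIncl g x)) ?_ ?_ ?_ ha
  · rw [zero_lie]; exact zero_mem _
  · intro y z hy hz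
    rw [add_lie]; exact add_mem hy hz
  intro f e hf
  refine regular_induction
    (p := fun c => ⁅f ⊗ₜ[ℂ] e, c⁆ ∈ LinearMap.range (regularIncl g x)) ?_ ?_ ?_ hc
  · rw [lie_zero]; exact zero_mem _
  · intro y z hy hz
    rw [lie_add]; exact add_mem hy hz
  intro f' e' hf'
  exact tmul_mem_range_regularIncl (mul_mem hf hf') _

theorem del_mem_range_regularIncl {a : Mer g} (ha : a ∈ LinearMap.range (regularIncl g x)) :
    del a ∈ LinearMap.range (regularIncl g x) := by
  refine regular_induction (p := fun a => del a ∈ LinearMap.range (regularIncl g x)) ?_ ?_ ?_ ha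
  · rw [map_zero]; exact zero_mem _
  · intro y z hy hz
    rw [map_add]; exact add_mem hy hz
  · intro f e hf
    exact tmul_mem_range_regularIncl (ddt_mem_regularAt hf) e

variable (g x) in
/-- The `𝔤`-valued meromorphic functions with a zero of order at least `k` at `x`. -/
def lattice (k : ℤ) : Submodule ℂ (Mer g) :=
  (LinearMap.range (regularIncl g x)).comap
    (Algebra.lsmul ℂ ℂ (Mer g) (localParam x ^ (-k)))

theorem mem_lattice_iff {k : ℤ} {a : Mer g} : a ∈ lattice g x k ↔
    localParam x ^ (-k) • a ∈ LinearMap.range (regularIncl g x) := Iff.rfl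

theorem lattice_zero : lattice g x 0 = LinearMap.range (regularIncl g x) := by
  ext a
  rw [mem_lattice_iff, neg_zero, zpow_zero, one_smul]

theorem tmul_mem_lattice {k : ℤ} {f : RatFunc ℂ} (hf : localParam x ^ (-k) * f ∈ regularAt x)
    (e : g) : f ⊗ₜ[ℂ] e ∈ lattice g x k := by
  rw [mem_lattice_iff, TensorProduct.smul_tmul']
  exact tmul_mem_range_regularIncl hf e

theorem lie_mem_lattice {j k : ℤ} {a c : Mer g} (ha : a ∈ lattice g x j)
    (hc : c ∈ lattice g x k) : ⁅a, c⁆ ∈ lattice g x (j + k) := by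
  rw [mem_lattice_iff, neg_add, zpow_add₀ localParam_ne_zero, mul_smul, ← lie_smul, ← smul_lie]
  exact lie_mem_range_regularIncl ha hc

theorem lattice_anti {k l : ℤ} (h : k ≤ l) : lattice g x l ≤ lattice g x k := by
  intro a ha
  obtain ⟨n, rfl⟩ := Int.le.dest h
  rw [mem_lattice_iff] at ha ⊢
  have h1 : localParam x ^ (-k) • a = (localParam x ^ n) • localParam x ^ (-(k + n)) • a := by
    rw [smul_smul, ← zpow_natCast, ← zpow_add₀ localParam_ne_zero]
    congr 2
    ring
  rw [h1]
  exact smul_mem_range_regularIncl (pow_mem localParam_mem_regularAt n) ha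

open LieAlgebra

theorem ad_pow_mem_lattice {a y : Mer g} {m : ℤ} (ha : a ∈ lattice g x (-1))
    (hy : y ∈ lattice g x m) (i : ℕ) :
    (ad (RatFunc ℂ) (Mer g) a ^ i) y ∈ lattice g x (m - i) := by
  induction i with
  | zero => simpa using hy
  | succ i ih =>
    rw [pow_succ', Module.End.mul_apply, ad_apply]
    convert lie_mem_lattice ha ih using 1
    push_cast
    ring_nf

/-- Every term of the expanded difference contains a factor `ad c`, which gains `k` orders, while
each factor loses at most one. The induction uses `u^(i+1) - v^(i+1) = u (u^i - v^i) + (u - v) v^i`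
with `u = ad (a + c)` and `v = ad a`. -/
theorem ad_add_pow_sub_mem_lattice {a c y : Mer g} {m k : ℤ} (hk : 0 ≤ k)
    (ha : a ∈ lattice g x (-1)) (hc : c ∈ lattice g x k) (hy : y ∈ lattice g x m) (i : ℕ) :
    (ad (RatFunc ℂ) (Mer g) (a + c) ^ i) y - (ad (RatFunc ℂ) (Mer g) a ^ i) y ∈
      lattice g x (m + k - i) := by
  induction i with
  | zero => simp
  | succ i ih =>
    have h1 : a + c ∈ lattice g x (-1) := add_mem ha (lattice_anti (by omega) hc)
    have h2 := lie_mem_lattice h1 ih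
    have h3 := lie_mem_lattice hc (ad_pow_mem_lattice ha hy i)
    have h4 := add_mem
      (lattice_anti (by push_cast; omega : m + k - ((i + 1 : ℕ) : ℤ) ≤ _) h2)
      (lattice_anti (by push_cast; omega : m + k - ((i + 1 : ℕ) : ℤ) ≤ _) h3)
    convert h4 using 1
    rw [pow_succ', Module.End.mul_apply, ad_apply, pow_succ', Module.End.mul_apply, ad_apply,
      lie_sub, add_lie, add_lie]
    abel

end Lattices

/-! ### Recovering elements from their brackets; perturbing exponentials -/

section Semisimple

open LieAlgebra LieAlgebra.IsKilling

variable {g : Type*} [LieRing g] [LieAlgebra ℂ g] [FiniteDimensional ℂ g]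
  [LieAlgebra.IsSemisimple ℂ g] {x : ℂ}

variable (g) in
-- The centre is trivial, so bracketing with a basis is injective on `𝔤` and has a linear left
-- inverse over `ℂ`. Its coefficients are constant, so it yields both the uniqueness of logarithmic
-- derivatives and their regularity.
theorem exists_recover_from_lie : ∃ (n : ℕ) (v : Fin n → g) (l : Fin n → g →ₗ[ℂ] g),
    ∀ X : Mer g, X = ∑ i, (l i).lTensor (RatFunc ℂ) ⁅X, 1 ⊗ₜ[ℂ] v i⁆ := by
  let v := Module.finBasis ℂ g
  let A : g →ₗ[ℂ] (Fin (Module.finrank ℂ g) → g) :=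
    LinearMap.pi fun i => -(ad ℂ g (v i) : g →ₗ[ℂ] g)
  have hA : LinearMap.ker A = ⊥ := by
    rw [LinearMap.ker_eq_bot']
    intro e he
    have h1 : ad ℂ g e = 0 := by
      refine v.ext fun i => ?_
      have := congrFun he i
      rw [ad_apply, ← lie_skew]
      exact this
    have h2 : e ∈ LieAlgebra.center ℂ g := by
      refine (LieModule.mem_maxTrivSubmodule ℂ g g e).mpr fun z => ?_
      rw [← lie_skew, ← ad_apply ℂ, h1, LinearMap.zero_apply, neg_zero]
    rw [LieAlgebra.center_eq_bot] at h2
    exact h2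
  obtain ⟨l, hl⟩ := LinearMap.exists_leftInverse_of_injective A hA
  refine ⟨_, v, fun i => l ∘ₗ LinearMap.single ℂ (fun _ => g) i, fun X => ?_⟩
  induction X using TensorProduct.induction_on with
  | zero => simp
  | add y z hy hz =>
    conv_lhs => rw [hy, hz]
    simp only [add_lie, map_add, Finset.sum_add_distrib]
  | tmul f e =>
    simp only [LieAlgebra.ExtendScalars.bracket_tmul, mul_one, LinearMap.lTensor_tmul]
    rw [← TensorProduct.tmul_sum]
    congr 1
    conv_lhs => rw [← LinearMap.id_apply (R := ℂ) e, ← hl, LinearMap.comp_apply]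
    simp only [LinearMap.comp_apply]
    rw [← map_sum]
    congr 1
    conv_lhs => rw [← LinearMap.sum_single_apply (φ := fun _ => g) (A e)]
    refine Finset.sum_congr rfl fun i _ => ?_
    congr 1
    simp [A]

theorem eq_of_forall_lie_eq {X Y : Mer g} (h : ∀ y : Mer g, ⁅X, y⁆ = ⁅Y, y⁆) : X = Y := by
  obtain ⟨n, v, l, hl⟩ := exists_recover_from_lie g
  rw [hl X, hl Y]
  simp only [h]

theorem IsLogDeriv.unique {φ : Mer g ≃ₗ⁅RatFunc ℂ⁆ Mer g} {X Y : Mer g} (hX : IsLogDeriv φ X)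
    (hY : IsLogDeriv φ Y) : X = Y :=
  eq_of_forall_lie_eq fun y => by
    have h1 := hX (φ⁻¹ y)
    have h2 := hY (φ⁻¹ y)
    rw [h1, aut_apply_inv_self] at h2
    exact h2

theorem mem_of_forall_lie_mem {X : Mer g}
    (h : ∀ e : g, ⁅X, (1 : RatFunc ℂ) ⊗ₜ[ℂ] e⁆ ∈ LinearMap.range (regularIncl g x)) :
    X ∈ LinearMap.range (regularIncl g x) := by
  obtain ⟨n, v, l, hl⟩ := exists_recover_from_lie g
  rw [hl X]
  refine Submodule.sum_mem _ fun i _ => ?_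
  refine regular_induction (p := fun y => (l i).lTensor (RatFunc ℂ) y ∈
    LinearMap.range (regularIncl g x)) ?_ ?_ ?_ (h (v i))
  · rw [map_zero]; exact zero_mem _
  · intro y z hy hz
    rw [map_add]; exact add_mem hy hz
  · intro f e hf
    exact tmul_mem_range_regularIncl hf _

/-- For constant `e`, the bracket `[X, e] = ∂e - φ(∂(φ⁻¹ e))` is built from operations that preserve
regularity, and `X` is recovered from these brackets. -/
theorem isRegular_logDeriv {φ : Mer g ≃ₗ⁅RatFunc ℂ⁆ Mer g} {X : Mer g} (hX : IsLogDeriv φ X)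
    (h : ∀ y ∈ LinearMap.range (regularIncl g x), φ y ∈ LinearMap.range (regularIncl g x))
    (h' : ∀ y ∈ LinearMap.range (regularIncl g x), φ⁻¹ y ∈ LinearMap.range (regularIncl g x)) :
    X ∈ LinearMap.range (regularIncl g x) := by
  refine mem_of_forall_lie_mem fun e => ?_
  have he : (1 : RatFunc ℂ) ⊗ₜ[ℂ] e ∈ LinearMap.range (regularIncl g x) :=
    tmul_mem_range_regularIncl (one_mem _) e
  have h1 := hX (φ⁻¹ (1 ⊗ₜ[ℂ] e))
  rw [aut_apply_inv_self] at h1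
  rw [← h1]
  exact sub_mem (del_mem_range_regularIncl he) (h _ (del_mem_range_regularIncl (h' _ he)))

variable {H : LieSubalgebra ℂ g} [H.IsCartanSubalgebra] {b : (rootSystem H).Base}

theorem expAd_mem_lattice {a y : Mer g} {m : ℤ} (ha : a ∈ filtration b 1)
    (hax : a ∈ lattice g x (-1)) (hy : y ∈ lattice g x m) :
    expAd a ha y ∈ lattice g x (m - nilpotencyBound b) := by
  rw [expAd_apply_eq_sum ha (k := nilpotencyBound b) (by rw [ad_pow_eq_zero ha]; rfl)]
  refine Submodule.sum_mem _ fun i hi => Submodule.smul_mem _ _ ?_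
  have := Finset.mem_range.mp hi
  exact lattice_anti (by omega) (ad_pow_mem_lattice hax hy i)

theorem expAd_add_sub_mem_lattice {a c y : Mer g} {m k : ℤ} (hk : 0 ≤ k)
    (ha : a ∈ filtration b 1) (hac : a + c ∈ filtration b 1) (hax : a ∈ lattice g x (-1))
    (hcx : c ∈ lattice g x k) (hy : y ∈ lattice g x m) :
    expAd (a + c) hac y - expAd a ha y ∈ lattice g x (m + k - nilpotencyBound b) := by
  rw [expAd_apply_eq_sum ha (k := nilpotencyBound b) (by rw [ad_pow_eq_zero ha]; rfl),
    expAd_apply_eq_sum hac (k := nilpotencyBound b) (by rw [ad_pow_eq_zero hac]; rfl),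
    ← Finset.sum_sub_distrib]
  refine Submodule.sum_mem _ fun i hi => ?_
  rw [← smul_sub]
  have := Finset.mem_range.mp hi
  exact Submodule.smul_mem _ _
    (lattice_anti (by omega) (ad_add_pow_sub_mem_lattice hk hax hcx hy i))

/-- A perturbation of `a` that vanishes to high order at `x` changes `exp (ad a)` only by a factor
that is regular at `x`. -/
theorem expAd_add_mul_inv_mem {a c : Mer g}
    (ha : a ∈ filtration b 1) (hac : a + c ∈ filtration b 1) (hax : a ∈ lattice g x (-1))
    (hcx : c ∈ lattice g x (2 * nilpotencyBound b)) {y : Mer g}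
    (hy : y ∈ LinearMap.range (regularIncl g x)) :
    (expAd (a + c) hac * (expAd a ha)⁻¹) y ∈ LinearMap.range (regularIncl g x) := by
  rw [← lattice_zero] at hy ⊢
  -- With `N = nilpotencyBound b`, the factor `exp(-a)` loses at most `N` orders and the difference
  -- `exp(a + c) - exp(a)` loses at most `N` more; the `2N` zeros of `c` compensate.
  have h1 := expAd_mem_lattice (neg_mem ha) (neg_mem hax) hy
  rw [← expAd_inv_apply ha] at h1
  have h2 := expAd_add_sub_mem_lattice (by omega) ha hac hax hcx h1
  rw [aut_apply_inv_self] at h2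
  have h3 := add_mem (lattice_anti (by omega : (0 : ℤ) ≤ _) h2) hy
  simpa using h3

/-- The inverse is `exp(a) exp(-a - c)`, so here the difference `exp(-a - c) - exp(-a)` is estimated
first and `exp(a)` is applied to it afterwards. -/
theorem expAd_mul_add_inv_mem {a c : Mer g}
    (ha : a ∈ filtration b 1) (hac : a + c ∈ filtration b 1) (hax : a ∈ lattice g x (-1))
    (hcx : c ∈ lattice g x (2 * nilpotencyBound b)) {y : Mer g}
    (hy : y ∈ LinearMap.range (regularIncl g x)) :
    (expAd (a + c) hac * (expAd a ha)⁻¹)⁻¹ y ∈ LinearMap.range (regularIncl g x) := by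
  rw [← lattice_zero] at hy ⊢
  have hac' : -a + -c ∈ filtration b 1 := by rw [← neg_add]; exact neg_mem hac
  have h1 := expAd_add_sub_mem_lattice (by omega) (neg_mem ha) hac' (neg_mem hax) (neg_mem hcx) hy
  have h2 := expAd_mem_lattice ha hax h1
  have h3 := add_mem (lattice_anti (by omega : (0 : ℤ) ≤ _) h2) hy
  convert h3 using 1
  have h4 : expAd (-a + -c) hac' y = (expAd (a + c) hac)⁻¹ y := by
    rw [expAd_inv_apply]
    congr 1
    simp only [neg_add]
  rw [map_sub, h4, ← expAd_inv_apply ha, aut_apply_inv_self, mul_inv_rev, inv_inv, aut_mul_apply,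
    sub_add_cancel]

end Semisimple

open LieAlgebra LieAlgebra.IsKilling

/-! ### The Killing form on `𝔤(𝓜)` and pairings with roots -/

section RegularValued

variable {g : Type*} [LieRing g] [LieAlgebra ℂ g] {H : LieSubalgebra ℂ g} {x : ℂ}

theorem killingForm_tmul [FiniteDimensional ℂ g] (f f' : RatFunc ℂ) (e e' : g) :
    killingForm (RatFunc ℂ) (Mer g) (f ⊗ₜ[ℂ] e) (f' ⊗ₜ[ℂ] e') =
      killingForm ℂ g e e' • (f * f') := by
  have h := LieModule.traceForm_baseChange ℂ g g (RatFunc ℂ)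
  have h1 := congrArg (fun B => B (f ⊗ₜ[ℂ] e) (f' ⊗ₜ[ℂ] e')) h
  refine h1.trans ?_
  rw [LinearMap.BilinForm.baseChange_tmul, mul_comm]

theorem killingForm_mem_regularAt [FiniteDimensional ℂ g] {y z : Mer g} (hy : y ∈ LinearMap.range (regularIncl g x))
    (hz : z ∈ LinearMap.range (regularIncl g x)) :
    killingForm (RatFunc ℂ) (Mer g) y z ∈ regularAt x := by
  refine regular_induction (p := fun y => killingForm (RatFunc ℂ) (Mer g) y z ∈ regularAt x)
    ?_ ?_ ?_ hy
  · rw [map_zero]; exact zero_mem _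
  · intro y y' h h'
    rw [map_add]; exact add_mem h h'
  intro f e hf
  refine regular_induction
    (p := fun z => killingForm (RatFunc ℂ) (Mer g) (f ⊗ₜ[ℂ] e) z ∈ regularAt x) ?_ ?_ ?_ hz
  · rw [map_zero]; exact zero_mem _
  · intro y y' h h'
    rw [map_add]; exact add_mem h h'
  intro f' e' hf'
  rw [killingForm_tmul]
  exact Subalgebra.smul_mem _ (mul_mem hf hf') _

theorem ddt_killingForm_const [FiniteDimensional ℂ g] (p : g) (y : Mer g) :
    ddt (killingForm (RatFunc ℂ) (Mer g) (1 ⊗ₜ[ℂ] p) y) =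
      killingForm (RatFunc ℂ) (Mer g) (1 ⊗ₜ[ℂ] p) (del y) := by
  induction y using TensorProduct.induction_on with
  | zero => simp
  | add y z hy hz => simp only [map_add, hy, hz]
  | tmul f e => rw [del_tmul, killingForm_tmul, killingForm_tmul, Derivation.map_smul, one_mul,
    one_mul]

/-- The function `⟨α, r⟩` for a regular `𝔥`-valued function `r`. -/
def pairingFun (α : H →ₗ[ℂ] ℂ) (r : regularAt x ⊗[ℂ] H) : regularAt x :=
  TensorProduct.rid ℂ (regularAt x) (α.lTensor (regularAt x) r)

theorem evalAt_pairingFun (α : H →ₗ[ℂ] ℂ) (r : regularAt x ⊗[ℂ] H) :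
    evalAt x (pairingFun α r) = α (valueAt x r) := by
  unfold pairingFun valueAt
  induction r using TensorProduct.induction_on with
  | zero => simp
  | add y z hy hz => simp only [map_add, hy, hz]
  | tmul f y => simp [mul_comm]

theorem cartanIncl_regularIncl_mem (r : regularAt x ⊗[ℂ] H) :
    cartanIncl H (regularIncl H x r) ∈ LinearMap.range (regularIncl g x) := by
  induction r using TensorProduct.induction_on with
  | zero => simp
  | add y z hy hz => simp only [map_add]; exact add_mem hy hz
  | tmul f y => exact tmul_mem_range_regularIncl f.2 (y : g)

end RegularValued

variable {g : Type*} [LieRing g] [LieAlgebra ℂ g] [FiniteDimensional ℂ g]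
  [LieAlgebra.IsSemisimple ℂ g] {H : LieSubalgebra ℂ g} [H.IsCartanSubalgebra]
  {b : (rootSystem H).Base} {x : ℂ}

section KillingForm

theorem killingForm_eq_zero_of_isHomogeneous {i j : ℤ} (hij : i + j ≠ 0) {e f : g}
    (he : IsHomogeneous b i e) (hf : IsHomogeneous b j f) : killingForm ℂ g e f = 0 := by
  obtain ⟨χ, h, he⟩ := he
  obtain ⟨ψ, h', hf⟩ := hf
  refine killingForm_apply_eq_zero_of_mem_rootSpace_of_add_ne_zero ℂ g H he hf fun h0 => hij ?_
  have := congrFun h0 (rhoCheck b)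
  rw [Pi.add_apply, h, h', Pi.zero_apply] at this
  exact_mod_cast this

theorem killingForm_eq_zero_of_mem_filtration {i j : ℤ} (hij : 0 < i + j) {y z : Mer g}
    (hy : y ∈ filtration b i) (hz : z ∈ filtration b j) :
    killingForm (RatFunc ℂ) (Mer g) y z = 0 := by
  refine filtration_induction (p := fun y => killingForm (RatFunc ℂ) (Mer g) y z = 0)
    ?_ ?_ ?_ hy
  · rw [map_zero]; rfl
  · intro y y' _ _ h h'
    rw [map_add, LinearMap.add_apply, h, h', add_zero]
  intro f e k hk he
  refine filtration_induction
    (p := fun z => killingForm (RatFunc ℂ) (Mer g) (f ⊗ₜ[ℂ] e) z = 0) ?_ ?_ ?_ hz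
  · rw [map_zero]
  · intro y y' _ _ h h'
    rw [map_add, h, h', add_zero]
  intro f' e' k' hk' he'
  rw [killingForm_tmul, killingForm_eq_zero_of_isHomogeneous (by omega) he he', zero_smul]

end KillingForm

/-! ### The quadratic gauge invariant -/

section QuadraticInvariant

variable (b) in
/-- The quadratic gauge invariant `κ(A, A) + 2 ∂ κ(ρ^∨, A)` of a connection `d + A dt` with
`A ∈ p₋₁ + 𝔟(𝓜)`. -/
def quadraticInvariant (A : Mer g) : RatFunc ℂ :=
  killingForm (RatFunc ℂ) (Mer g) A A +
    2 * ddt (killingForm (RatFunc ℂ) (Mer g) (1 ⊗ₜ[ℂ] (rhoCheck b : g)) A)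

theorem gauge_sub_mem {p : g} (hp : (1 : RatFunc ℂ) ⊗ₜ[ℂ] p ∈ filtration b (-1))
    {φ : Mer g ≃ₗ⁅RatFunc ℂ⁆ Mer g} (hφ : IsUnipotentOfLevel b 1 φ) {X A : Mer g}
    (hX : X ∈ filtration b 1) (hA : A - 1 ⊗ₜ[ℂ] p ∈ filtration b 0) :
    φ A - X - 1 ⊗ₜ[ℂ] p ∈ filtration b 0 := by
  have h1 := hφ.apply_mem zero_le_one hA
  have h2 := hφ _ _ hp
  have h3 := sub_mem (add_mem h1 h2) (filtration_anti zero_le_one hX)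
  convert h3 using 1
  rw [map_sub]
  abel

/-- Height considerations reduce the change of `κ(A, A)` to `-2 κ(p, X)`, and the change of `κ(ρ^∨,
A)` to `κ(p, φ⁻¹ρ^∨ - ρ^∨)`. The derivative of the latter is `κ(p, X)`, so the factor 2 in the
invariant makes the two changes cancel. -/
theorem quadraticInvariant_gauge {p : g} (hp : (1 : RatFunc ℂ) ⊗ₜ[ℂ] p ∈ filtration b (-1))
    (hp' : ⁅(rhoCheck b : g), p⁆ = -p) {φ : Mer g ≃ₗ⁅RatFunc ℂ⁆ Mer g}
    (hφ : IsUnipotentOfLevel b 1 φ) {X A : Mer g}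
    (hX : X ∈ filtration b 1) (hφX : IsLogDeriv φ X) (hA : A - 1 ⊗ₜ[ℂ] p ∈ filtration b 0) :
    quadraticInvariant b (φ A - X) = quadraticInvariant b A := by
  set κ := killingForm (RatFunc ℂ) (Mer g) with hκ
  set ρ : Mer g := 1 ⊗ₜ[ℂ] (rhoCheck b : g) with hρ
  set P : Mer g := 1 ⊗ₜ[ℂ] p with hP
  have hρ0 : ρ ∈ filtration b 0 := tmul_mem_filtration le_rfl 1 (isHomogeneous_cartan _)
  have symm : ∀ y z, κ y z = κ z y := fun y z => LieModule.traceForm_comm _ _ _ y z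
  have hA' := gauge_sub_mem hp hφ hX hA
  have hφi := hφ.inv le_rfl
  have h1 : κ (φ A) (φ A) = κ A A := killingForm_of_equiv_apply φ A A
  have h2 : κ X X = 0 := killingForm_eq_zero_of_mem_filtration (by norm_num) hX hX
  have h3 : κ (φ A) X = κ P X := by
    have e : φ A = (φ A - X - P) + P + X := by abel
    rw [e, map_add, map_add, LinearMap.add_apply, LinearMap.add_apply, h2,
      killingForm_eq_zero_of_mem_filtration (by norm_num) hA' hX]
    ring
  have h4 : κ ρ X = 0 := killingForm_eq_zero_of_mem_filtration (by norm_num) hρ0 hX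
  have hδ : φ⁻¹ ρ - ρ ∈ filtration b 1 := by simpa using hφi 0 ρ hρ0
  have h5 : κ ρ (φ A) = κ ρ A + (κ P (φ⁻¹ ρ) - κ P ρ) := by
    have e1 : κ ρ (φ A) = κ (φ⁻¹ ρ) A := by
      rw [hκ, ← killingForm_of_equiv_apply φ (φ⁻¹ ρ) A, aut_apply_inv_self]
    have e2 : κ (φ⁻¹ ρ - ρ) (A - P) = 0 :=
      killingForm_eq_zero_of_mem_filtration (by norm_num) hδ hA
    rw [e1, symm P, symm P]
    simp only [map_sub, LinearMap.sub_apply] at e2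
    linear_combination e2
  have h6 : ddt (κ P ρ) = 0 := by
    rw [ddt_killingForm_const, hρ, del_tmul]
    simp
  -- As `ρ^∨` is constant, `∂(φ⁻¹ρ^∨) = φ⁻¹[ρ^∨, X]`. Against `p`, of height -1, only the height 1
  -- part counts, so `φ⁻¹` drops out; invariance of `κ` and `[p, ρ^∨] = p` finish.
  have h7 : ddt (κ P (φ⁻¹ ρ)) = κ P X := by
    have e1 := hφX (φ⁻¹ ρ)
    rw [aut_apply_inv_self, hρ, del_tmul, Derivation.map_one_eq_zero, TensorProduct.zero_tmul,
      zero_sub, ← hρ] at e1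
    have e2 : del (φ⁻¹ ρ) = φ⁻¹ ⁅ρ, X⁆ := by
      rw [← lie_skew, ← e1, neg_neg, aut_inv_apply_self]
    have e3 : κ P (φ⁻¹ ⁅ρ, X⁆ - ⁅ρ, X⁆) = 0 :=
      killingForm_eq_zero_of_mem_filtration (i := -1) (j := 0 + 1 + 1) (by norm_num) hp
        (hφi _ _ (lie_mem_filtration hρ0 hX))
    have e4 : κ P ⁅ρ, X⁆ = κ ⁅P, ρ⁆ X := (LieModule.traceForm_apply_lie_apply _ _ _ P ρ X).symm
    have e5 : ⁅P, ρ⁆ = P := by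
      rw [← lie_skew, hρ, hP, LieAlgebra.ExtendScalars.bracket_tmul, hp', TensorProduct.tmul_neg,
        neg_neg, one_mul]
    rw [ddt_killingForm_const, e2]
    rw [map_sub, e4, e5, sub_eq_zero] at e3
    exact e3
  unfold quadraticInvariant
  rw [← hκ, ← hρ]
  have h8 : κ ρ (φ A - X) = κ ρ A + (κ P (φ⁻¹ ρ) - κ P ρ) := by rw [map_sub, h4, h5, sub_zero]
  rw [h8, map_add ddt, map_sub ddt, h6, h7]
  simp only [map_sub, LinearMap.sub_apply, h1, h2, h3, symm X (φ A)]
  ring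

theorem quadraticInvariant_mem_regularAt {A : Mer g}
    (hA : A ∈ LinearMap.range (regularIncl g x)) : quadraticInvariant b A ∈ regularAt x := by
  refine add_mem (killingForm_mem_regularAt hA hA) (mul_mem ?_ (ddt_mem_regularAt
    (killingForm_mem_regularAt (tmul_mem_range_regularIncl (one_mem _) _) hA)))
  exact ofNat_mem (regularAt x) 2

end QuadraticInvariant

/-! ### Generators, the invariant of a Miura connection, and necessity -/

section Generators

variable (C : ChevalleyGenerators b)

theorem ChevalleyGenerators.isHomogeneous_E (i : b.support) : IsHomogeneous b 1 (C.E i) := by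
  have := isHomogeneous_root (b := b) (C.E_mem i)
  rwa [b.height_one_of_mem_support i.2] at this

theorem ChevalleyGenerators.isHomogeneous_F (i : b.support) : IsHomogeneous b (-1) (C.F i) := by
  refine ⟨_, ?_, C.F_mem i⟩
  have := root_apply_rhoCheck b i.1
  rw [b.height_one_of_mem_support i.2] at this
  rw [Pi.neg_apply, this]
  push_cast
  rfl

variable (D : CyclotomicDatum b)

theorem CyclotomicDatum.pMinus_mem_filtration (f : RatFunc ℂ) :
    f ⊗ₜ[ℂ] D.pMinus ∈ filtration b (-1) := by
  rw [CyclotomicDatum.pMinus, TensorProduct.tmul_sum]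
  exact Submodule.sum_mem _ fun i _ =>
    tmul_mem_filtration le_rfl f (D.toChevalleyGenerators.isHomogeneous_F i)

theorem CyclotomicDatum.lie_rhoCheck_pMinus : ⁅(rhoCheck b : g), D.pMinus⁆ = -D.pMinus := by
  rw [CyclotomicDatum.pMinus, lie_sum, ← Finset.sum_neg_distrib]
  refine Finset.sum_congr rfl fun i _ => ?_
  rw [(D.toChevalleyGenerators.isHomogeneous_F i).lie_rhoCheck]
  simp

theorem CyclotomicDatum.killingForm_pMinus_cartan (y : H) :
    killingForm ℂ g D.pMinus (y : g) = 0 := by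
  rw [CyclotomicDatum.pMinus, map_sum, LinearMap.sum_apply]
  exact Finset.sum_eq_zero fun i _ => killingForm_eq_zero_of_isHomogeneous (by norm_num)
    (D.toChevalleyGenerators.isHomogeneous_F i) (isHomogeneous_cartan y)

theorem killingForm_coroot (α : H.root) (y : H) :
    killingForm ℂ g ((rootSystem H).coroot α : g) (y : g) =
      2 * (α.1 ((cartanEquivDual H).symm α.1))⁻¹ * α.1 y := by
  refine (traceForm_coroot α.1 y).trans ?_
  rw [nsmul_eq_mul, smul_eq_mul, Nat.cast_ofNat, mul_assoc]

end Generators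

section CartanValued

theorem killingForm_coroot_cartanIncl (α : H.root) (f : RatFunc ℂ) (r : regularAt x ⊗[ℂ] H) :
    killingForm (RatFunc ℂ) (Mer g) (f ⊗ₜ[ℂ] ((rootSystem H).coroot α : g))
      (cartanIncl H (regularIncl H x r)) =
      (2 * (α.1 ((cartanEquivDual H).symm α.1))⁻¹) •
        (f * (pairingFun ((rootSystem H).root α) r).1) := by
  unfold pairingFun
  induction r using TensorProduct.induction_on with
  | zero => simp
  | add y z hy hz => simp only [map_add, hy, hz, Subalgebra.coe_add, mul_add, smul_add]
  | tmul f' y =>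
    change killingForm (RatFunc ℂ) (Mer g) _ (f'.1 ⊗ₜ[ℂ] (y : g)) = _
    rw [killingForm_tmul, killingForm_coroot, mul_smul, LinearMap.lTensor_tmul,
      TensorProduct.rid_tmul, Subalgebra.coe_smul, mul_smul_comm]
    rfl

theorem killingForm_pMinus_cartanIncl (D : CyclotomicDatum b) (u : RatFunc ℂ ⊗[ℂ] H) :
    killingForm (RatFunc ℂ) (Mer g) (1 ⊗ₜ[ℂ] D.pMinus) (cartanIncl H u) = 0 := by
  induction u using TensorProduct.induction_on with
  | zero => simp
  | add y z hy hz => simp only [map_add, hy, hz, add_zero]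
  | tmul f y =>
    change killingForm (RatFunc ℂ) (Mer g) _ (f ⊗ₜ[ℂ] (y : g)) = _
    rw [killingForm_tmul, D.killingForm_pMinus_cartan, zero_smul]

end CartanValued

/-- For a Miura connection with residue `α^∨`, regularity of the quadratic invariant at `x` forces
`⟨α, r(x)⟩ = 0`. -/
theorem pairing_eq_zero_of_quadraticInvariant_mem (D : CyclotomicDatum b) (i : b.support)
    (r : regularAt x ⊗[ℂ] H)
    (h : quadraticInvariant b (1 ⊗ₜ[ℂ] D.pMinus + cartanIncl H ((localParam x)⁻¹ ⊗ₜ[ℂ]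
      (rootSystem H).coroot i.1 + regularIncl H x r)) ∈ regularAt x) :
    (rootSystem H).root i.1 (valueAt x r) = 0 := by
  rw [← evalAt_pairingFun, evalAt_eq_zero_iff]
  set κ := killingForm (RatFunc ℂ) (Mer g) with hκ
  set w := (localParam x)⁻¹ with hw
  set P : Mer g := 1 ⊗ₜ[ℂ] D.pMinus with hP
  set U := w ⊗ₜ[ℂ] (rootSystem H).coroot i.1 + regularIncl H x r with hU
  set ρ : Mer g := 1 ⊗ₜ[ℂ] (rhoCheck b : g) with hρ
  set c := 2 * (i.1.1 ((cartanEquivDual H).symm i.1.1))⁻¹ with hc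
  have symm : ∀ y z, κ y z = κ z y := fun y z => LieModule.traceForm_comm _ _ _ y z
  have hc0 : c ≠ 0 := mul_ne_zero two_ne_zero
    (inv_ne_zero (root_apply_cartanEquivDual_symm_ne_zero (LieSubalgebra.isNonZero_coe_root i.1)))
  set R : Mer g := cartanIncl H (regularIncl H x r) with hR
  have hRreg : R ∈ LinearMap.range (regularIncl g x) := cartanIncl_regularIncl_mem r
  set a : Mer g := w ⊗ₜ[ℂ] ((rootSystem H).coroot i.1 : g) with ha
  have hUa : cartanIncl H U = a + R := by rw [hU, map_add]; rfl
  have h1 : κ P (a + R) = 0 := by rw [← hUa]; exact killingForm_pMinus_cartanIncl D U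
  have h2 : κ a R = c • (w * (pairingFun ((rootSystem H).root i.1) r).1) :=
    killingForm_coroot_cartanIncl i.1 w r
  have h3 : κ a a = (c * 2) • (w * w) := by
    rw [hκ, ha, killingForm_tmul, killingForm_coroot]
    congr 2
    exact root_apply_coroot (LieSubalgebra.isNonZero_coe_root i.1)
  have h4 : κ ρ a = c • w := by
    rw [symm, hκ, ha, hρ, killingForm_tmul, killingForm_coroot, root_apply_rhoCheck,
      b.height_one_of_mem_support i.2, mul_one, Int.cast_one, mul_one]
  have h5 : κ ρ P ∈ regularAt x := killingForm_mem_regularAt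
    (tmul_mem_range_regularIncl (one_mem _) _) (tmul_mem_range_regularIncl (one_mem _) _)
  have h6 : κ ρ R ∈ regularAt x := killingForm_mem_regularAt
    (tmul_mem_range_regularIncl (one_mem _) _) hRreg
  have h7 : κ R R ∈ regularAt x := killingForm_mem_regularAt hRreg hRreg
  have h8 : κ P P ∈ regularAt x := killingForm_mem_regularAt
    (tmul_mem_range_regularIncl (one_mem _) _) (tmul_mem_range_regularIncl (one_mem _) _)
  -- The double poles `2c w²` from `κ(a, a)` and `-2c w²` from `2 ∂κ(ρ^∨, a)` cancel; the last
  -- summand is `2 κ(a, R)`.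
  have h9 : quadraticInvariant b (P + cartanIncl H U) =
      κ P P + κ R R + 2 * (ddt (κ ρ P) + ddt (κ ρ R)) +
        (2 * c) • (w * (pairingFun ((rootSystem H).root i.1) r).1) := by
    unfold quadraticInvariant
    rw [← hκ, ← hρ, hUa, map_add κ P, LinearMap.add_apply, map_add (κ P), h1, map_add (κ (a + R)),
      symm (a + R) P, h1, map_add κ a, LinearMap.add_apply, map_add (κ a), map_add (κ R), h3,
      symm R a, h2, map_add (κ ρ), map_add (κ ρ), h4, map_add ddt, map_add ddt, Derivation.map_smul, hw,
      ddt_inv_localParam, ← hw]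
    simp only [RatFunc.smul_eq_C_mul, map_mul, map_ofNat]
    ring
  rw [h9] at h
  have two_mem : (2 : RatFunc ℂ) ∈ regularAt x := ofNat_mem (regularAt x) 2
  have h10 := sub_mem h (add_mem (add_mem h8 h7)
    (mul_mem two_mem (add_mem (ddt_mem_regularAt h5) (ddt_mem_regularAt h6))))
  rw [add_sub_cancel_left] at h10
  have h11 := Subalgebra.smul_mem _ h10 (2 * c)⁻¹
  rwa [smul_smul, inv_mul_cancel₀ (mul_ne_zero two_ne_zero hc0), one_smul] at h11

theorem root_valueAt_eq_zero_of_isRegularAt (D : CyclotomicDatum b)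
    (M : D.CyclotomicMiuraOper) (i : b.support) (r : regularAt x ⊗[ℂ] H)
    (hM : M.u = (localParam x)⁻¹ ⊗ₜ[ℂ] (rootSystem H).coroot i.1 + regularIncl H x r)
    (h : M.underlyingOper.IsRegularAt x) :
    (rootSystem H).root i.1 (valueAt x r) = 0 := by
  obtain ⟨N, hN, hreg⟩ := h
  obtain ⟨φ, hφ, hg⟩ := Quotient.exact hN
  obtain ⟨X, hX, hA⟩ := hg
  obtain ⟨hu, X', hX', hlog⟩ := unipotent_of_mem_unipotentGroup hφ.1
  -- The logarithmic derivative supplied by the gauge relation is not known to lie in `𝔫(𝓜)` until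
  -- uniqueness identifies it with `X'`.
  obtain rfl := hX.unique hlog
  refine pairing_eq_zero_of_quadraticInvariant_mem D i r ?_
  have h1 : 1 ⊗ₜ[ℂ] D.pMinus + cartanIncl H M.u = φ N.coeff - X := hA
  have h2 : N.coeff - 1 ⊗ₜ[ℂ] D.pMinus ∈ filtration b 0 := by
    rw [← borel_baseChange_eq, CyclotomicDatum.OperConnection.coeff, add_sub_cancel_left]
    exact N.v_mem
  rw [← hM, h1, quadraticInvariant_gauge (D.pMinus_mem_filtration 1) D.lie_rhoCheck_pMinus hu hX'
    hlog h2]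
  exact quadraticInvariant_mem_regularAt
    (add_mem (tmul_mem_range_regularIncl (one_mem _) _) hreg)

/-! ### The action of the cyclic group, and orbit sums -/

section Pullback

theorem comp_mul_X_injective (c : ℂˣ) : Function.Injective
    (Polynomial.aeval (R := ℂ) (Polynomial.C (c : ℂ) * Polynomial.X)) := by
  refine Function.LeftInverse.injective
    (g := Polynomial.aeval (R := ℂ) (Polynomial.C ((c⁻¹ : ℂˣ) : ℂ) * Polynomial.X)) fun p => ?_
  rw [← Polynomial.comp_eq_aeval, ← Polynomial.comp_eq_aeval, Polynomial.comp_assoc]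
  simp [← mul_assoc, ← Polynomial.C_mul]

theorem pullback_algebraMap (c : ℂˣ) (p : Polynomial ℂ) :
    pullback c (algebraMap (Polynomial ℂ) (RatFunc ℂ) p) =
      algebraMap (Polynomial ℂ) (RatFunc ℂ) (p.comp (Polynomial.C (c : ℂ) * Polynomial.X)) := by
  rw [Polynomial.comp_eq_aeval]
  have h := RatFunc.map_apply_div (Polynomial.aeval (R := ℂ) (Polynomial.C (c : ℂ) * Polynomial.X))
    (nonZeroDivisors_le_comap_nonZeroDivisors_of_injective _ (comp_mul_X_injective c)) p 1
  simp only [map_one, div_one] at h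
  exact h

theorem ratFunc_algHom_ext {φ ψ : RatFunc ℂ →ₐ[ℂ] RatFunc ℂ}
    (h : ∀ p : Polynomial ℂ, φ (algebraMap (Polynomial ℂ) (RatFunc ℂ) p) =
      ψ (algebraMap (Polynomial ℂ) (RatFunc ℂ) p)) : φ = ψ := by
  refine AlgHom.ext fun f => ?_
  rw [← RatFunc.num_div_denom f, map_div₀, map_div₀, h, h]

theorem pullback_one : pullback 1 = AlgHom.id ℂ (RatFunc ℂ) :=
  ratFunc_algHom_ext fun p => by rw [pullback_algebraMap]; simp

theorem pullback_pullback (c d : ℂˣ) (f : RatFunc ℂ) :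
    pullback c (pullback d f) = pullback (d * c) f := by
  have h : (pullback c).comp (pullback d) = pullback (d * c) :=
    ratFunc_algHom_ext fun p => by
      rw [AlgHom.comp_apply, pullback_algebraMap, pullback_algebraMap, pullback_algebraMap,
        Polynomial.comp_assoc]
      simp [mul_assoc]
  exact DFunLike.congr_fun h f

theorem ddt_pullback (c : ℂˣ) (f : RatFunc ℂ) :
    ddt (pullback c f) = (c : ℂ) • pullback c (ddt f) := by
  have hpoly : ∀ p : Polynomial ℂ, ddt (pullback c (algebraMap (Polynomial ℂ) (RatFunc ℂ) p)) =
      (c : ℂ) • pullback c (ddt (algebraMap (Polynomial ℂ) (RatFunc ℂ) p)) := by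
    intro p
    rw [ddt_algebraMap, pullback_algebraMap, pullback_algebraMap, ddt_algebraMap,
      Polynomial.derivative_comp]
    simp [RatFunc.smul_eq_C_mul]
  conv_lhs => rw [← RatFunc.num_div_denom f]
  conv_rhs => rw [← RatFunc.num_div_denom f]
  simp only [map_div₀, Derivation.leibniz_div, hpoly, map_mul, map_sub, map_pow, smul_eq_mul,
    map_inv₀, RatFunc.smul_eq_C_mul]
  ring

end Pullback

section Twist

variable (D : CyclotomicDatum b)

namespace CyclotomicDatum

theorem twist_tmul (f : RatFunc ℂ) (e : g) :
    D.twist (f ⊗ₜ[ℂ] e) = pullback D.ω⁻¹ f ⊗ₜ[ℂ] D.ς e := rfl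

theorem twist_lie (y z : Mer g) : D.twist ⁅y, z⁆ = ⁅D.twist y, D.twist z⁆ := by
  induction y using TensorProduct.induction_on with
  | zero => simp
  | add y y' hy hy' => simp only [add_lie, map_add, hy, hy']
  | tmul f e =>
    induction z using TensorProduct.induction_on with
    | zero => simp
    | add y y' hy hy' => simp only [lie_add, map_add, hy, hy']
    | tmul f' e' =>
      simp only [LieAlgebra.ExtendScalars.bracket_tmul, twist_tmul, map_mul, LieEquiv.map_lie]

theorem del_twist (y : Mer g) : del (D.twist y) = ((D.ω⁻¹ : ℂˣ) : ℂ) • D.twist (del y) := by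
  induction y using TensorProduct.induction_on with
  | zero => simp
  | add y z hy hz => simp only [map_add, hy, hz, smul_add]
  | tmul f e => rw [twist_tmul, del_tmul, del_tmul, twist_tmul, ddt_pullback, TensorProduct.smul_tmul']

theorem twist_surjective : Function.Surjective D.twist := by
  refine TensorProduct.map_surjective (fun f => ⟨pullback D.ω f, ?_⟩) D.ς.surjective
  change pullback D.ω⁻¹ (pullback D.ω f) = f
  rw [pullback_pullback, mul_inv_cancel, pullback_one, AlgHom.id_apply]

theorem twistForm_pMinus : D.twistForm (1 ⊗ₜ[ℂ] D.pMinus) = 1 ⊗ₜ[ℂ] D.pMinus := by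
  have h : D.ς D.pMinus = (D.ω : ℂ) • D.pMinus := by
    rw [pMinus, map_sum, Finset.smul_sum]
    simp only [D.ς_F]
    exact Equiv.sum_comp D.ν fun i => (D.ω : ℂ) • D.F i
  rw [twistForm, twist_tmul, h, map_one, TensorProduct.tmul_smul, smul_smul, Units.inv_mul,
    one_smul]

theorem twistForm_add (y z : Mer g) : D.twistForm (y + z) = D.twistForm y + D.twistForm z := by
  rw [twistForm, map_add, smul_add]
  rfl

theorem twistForm_sub (y z : Mer g) : D.twistForm (y - z) = D.twistForm y - D.twistForm z := by
  rw [twistForm, map_sub, smul_sub]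
  rfl

/-- Moving `∂` past the twist produces the factor `ω⁻¹` that separates `twistForm` from `twist`. So
twisting the defining identity of `X` shows that `twistForm X` has the same brackets as `X`. -/
theorem twistForm_logDeriv {φ : Mer g ≃ₗ⁅RatFunc ℂ⁆ Mer g}
    (hφ : ∀ y, D.twist (φ y) = φ (D.twist y)) {X : Mer g} (hX : IsLogDeriv φ X) :
    D.twistForm X = X := by
  refine eq_of_forall_lie_eq fun y => ?_
  obtain ⟨z, rfl⟩ : ∃ z, y = D.twist (φ z) := by
    obtain ⟨z, hz⟩ := D.twist_surjective (φ⁻¹ y)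
    exact ⟨z, by rw [hφ, hz, aut_apply_inv_self]⟩
  rw [twistForm, smul_lie, ← twist_lie, ← hX z, hφ, ← hX, map_sub, smul_sub, ← del_twist, hφ,
    hφ, del_twist]
  congr 1
  exact ((φ : Mer g →ₗ⁅RatFunc ℂ⁆ Mer g).toLinearMap.map_smul_of_tower _ _).symm

theorem twistForm_apply {φ : Mer g ≃ₗ⁅RatFunc ℂ⁆ Mer g}
    (hφ : ∀ y, D.twist (φ y) = φ (D.twist y)) (y : Mer g) :
    D.twistForm (φ y) = φ (D.twistForm y) := by
  rw [twistForm, hφ, twistForm]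
  exact ((φ : Mer g →ₗ⁅RatFunc ℂ⁆ Mer g).toLinearMap.map_smul_of_tower _ _).symm

theorem twist_expAd {n : Mer g} (hn : n ∈ filtration b 1) (h : D.twist n = n) (y : Mer g) :
    D.twist (expAd n hn y) = expAd n hn (D.twist y) := by
  have hpow : ∀ i : ℕ, D.twist ((ad (RatFunc ℂ) (Mer g) n ^ i) y) =
      (ad (RatFunc ℂ) (Mer g) n ^ i) (D.twist y) := by
    intro i
    induction i with
    | zero => rfl
    | succ i ih =>
      rw [pow_succ', Module.End.mul_apply, Module.End.mul_apply, ad_apply, ad_apply, twist_lie, ih,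
        h]
  rw [expAd_apply_eq_sum hn (k := nilpotencyBound b) (by rw [ad_pow_eq_zero hn]; rfl),
    expAd_apply_eq_sum hn (k := nilpotencyBound b) (by rw [ad_pow_eq_zero hn]; rfl), map_sum]
  simp only [map_smul, hpow]

theorem twist_pow_tmul_E (k : ℕ) (f : RatFunc ℂ) (i : b.support) :
    (D.twist ^ k) (f ⊗ₜ[ℂ] D.E i) =
      (((D.ω⁻¹ ^ k : ℂˣ) : ℂ) • pullback (D.ω⁻¹ ^ k) f) ⊗ₜ[ℂ] D.E ((D.ν ^ k) i) := by
  induction k with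
  | zero => simp [pullback_one]
  | succ k ih =>
    rw [pow_succ', Module.End.mul_apply, ih, twist_tmul, AlgHom.map_smul_of_tower,
      pullback_pullback, D.ς_E,
      TensorProduct.tmul_smul, TensorProduct.smul_tmul', smul_smul, ← pow_succ, pow_succ' D.ν,
      Equiv.Perm.mul_apply, ← Units.val_mul, ← pow_succ']

/-- The sum over the cyclic group of the translates of `f E_i`. -/
def orbitSum (f : RatFunc ℂ) (i : b.support) : Mer g :=
  ∑ k ∈ Finset.range D.T, (D.twist ^ k) (f ⊗ₜ[ℂ] D.E i)

/-- The twist shifts the sum by one index, and its `T`-th power fixes `f E_i` because `ω^T = 1` and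
`ν^T = 1`. -/
theorem twist_orbitSum (f : RatFunc ℂ) (i : b.support) :
    D.twist (D.orbitSum f i) = D.orbitSum f i := by
  have hT : (D.twist ^ D.T) (f ⊗ₜ[ℂ] D.E i) = f ⊗ₜ[ℂ] D.E i := by
    have h1 : D.ω⁻¹ ^ D.T = 1 := by
      rw [inv_pow, D.isPrimitiveRoot_ω.pow_eq_one, inv_one]
    rw [twist_pow_tmul_E, h1, orderOf_dvd_iff_pow_eq_one.mp D.orderOf_ν_dvd, pullback_one]
    simp
  have h := Finset.sum_range_succ (fun k => (D.twist ^ k) (f ⊗ₜ[ℂ] D.E i)) D.T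
  rw [Finset.sum_range_succ', hT, pow_zero, Module.End.one_apply, add_left_inj] at h
  rw [orbitSum, map_sum]
  refine Eq.trans ?_ h
  refine Finset.sum_congr rfl fun k _ => ?_
  rw [pow_succ', Module.End.mul_apply]

theorem orbitSum_mem_filtration (f : RatFunc ℂ) (i : b.support) :
    D.orbitSum f i ∈ filtration b 1 := by
  refine Submodule.sum_mem _ fun k _ => ?_
  rw [twist_pow_tmul_E]
  exact tmul_mem_filtration le_rfl _ (D.toChevalleyGenerators.isHomogeneous_E _)

end CyclotomicDatum

end Twist

/-! ### Prescribing the behaviour of a rational function along an orbit -/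

section Approximation

theorem zpow_mul_div_mem_regularAt {k : ℕ} {p q : Polynomial ℂ}
    (hp : (Polynomial.X - Polynomial.C x) ^ k ∣ p) (hq : q.eval x ≠ 0) :
    localParam x ^ (-k : ℤ) * (algebraMap (Polynomial ℂ) (RatFunc ℂ) p /
      algebraMap (Polynomial ℂ) (RatFunc ℂ) q) ∈ regularAt x := by
  obtain ⟨s, rfl⟩ := hp
  rw [map_mul, map_pow, ← localParam_eq_algebraMap, mul_div_assoc, ← mul_assoc, zpow_neg,
    zpow_natCast, inv_mul_cancel₀ (pow_ne_zero k localParam_ne_zero), one_mul]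
  exact div_mem_regularAt s hq

/-- There is a rational function with polar part `-1 / (t - x)` at `x` up to order `K`, whose
translates by the nontrivial powers of `ζ` vanish to order `K` at `x`. -/
theorem exists_approximation (hx : x ≠ 0) {ζ : ℂˣ} {T : ℕ} (hζ : IsPrimitiveRoot ζ T) (K : ℕ) :
    ∃ f : RatFunc ℂ, localParam x ^ (-K : ℤ) * (f + (localParam x)⁻¹) ∈ regularAt x ∧
      ∀ k, 1 ≤ k → k < T → localParam x ^ (-K : ℤ) * pullback (ζ ^ k) f ∈ regularAt x := by
  have hne : ∀ k, 1 ≤ k → k < T → ((ζ ^ k : ℂˣ) : ℂ) * x - x ≠ 0 := by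
    intro k hk hkT h
    have h1 : (((ζ ^ k : ℂˣ) : ℂ) - 1) * x = 0 := by rw [← h]; ring
    have h2 := sub_eq_zero.mp ((mul_eq_zero.mp h1).resolve_right hx)
    exact hζ.pow_ne_one_of_pos_of_lt (by omega) hkT (Units.ext h2)
  -- The exponent is `K + 1` because one factor `t - x` is lost to the denominator of `f`.
  have hcop : IsCoprime ((Polynomial.X - Polynomial.C x) ^ (K + 1))
      (∏ k ∈ Finset.Ico 1 T, (Polynomial.X - Polynomial.C (((ζ ^ k : ℂˣ) : ℂ) * x)) ^ K) := by
    refine IsCoprime.prod_right fun k hk => IsCoprime.pow ?_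
    obtain ⟨h1, h2⟩ := Finset.mem_Ico.mp hk
    refine Polynomial.isCoprime_X_sub_C_of_isUnit_sub (IsUnit.mk0 _ fun h => hne k h1 h2 ?_)
    rw [← neg_eq_zero, ← h]
    ring
  obtain ⟨p, q, hpq⟩ := hcop
  set Q := ∏ k ∈ Finset.Ico 1 T, (Polynomial.X - Polynomial.C (((ζ ^ k : ℂˣ) : ℂ) * x)) ^ K
  -- Bézout's identity gives `-q Q / (t - x) = -1/(t - x) + p (t - x)^K`, while `Q` vanishes to
  -- order `K` at each `ζ^k x` with `1 ≤ k < T`.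
  refine ⟨-(algebraMap (Polynomial ℂ) (RatFunc ℂ) (q * Q) /
    algebraMap (Polynomial ℂ) (RatFunc ℂ) (Polynomial.X - Polynomial.C x)), ?_, ?_⟩
  · have h1 : -(algebraMap (Polynomial ℂ) (RatFunc ℂ) (q * Q) /
        algebraMap (Polynomial ℂ) (RatFunc ℂ) (Polynomial.X - Polynomial.C x)) +
        (localParam x)⁻¹ = algebraMap (Polynomial ℂ) (RatFunc ℂ)
          (p * (Polynomial.X - Polynomial.C x) ^ K) / algebraMap (Polynomial ℂ) (RatFunc ℂ) 1 := by
      rw [eq_sub_of_add_eq' hpq, map_one, div_one, map_sub, map_one, map_mul, map_mul, map_pow,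
        map_pow, ← localParam_eq_algebraMap]
      have := localParam_ne_zero (x := x)
      field_simp
      ring
    rw [h1]
    exact zpow_mul_div_mem_regularAt (Dvd.intro_left p rfl) (by simp)
  · intro k hk hkT
    rw [map_neg, map_div₀, pullback_algebraMap, pullback_algebraMap, mul_neg]
    refine neg_mem (zpow_mul_div_mem_regularAt ?_ ?_)
    · have h1 : (Polynomial.X - Polynomial.C (((ζ ^ k : ℂˣ) : ℂ) * x)) ^ K ∣ q * Q :=
        Dvd.dvd.mul_left (Finset.dvd_prod_of_mem (fun k =>
          (Polynomial.X - Polynomial.C (((ζ ^ k : ℂˣ) : ℂ) * x)) ^ K)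
          (Finset.mem_Ico.mpr ⟨hk, hkT⟩)) q
      obtain ⟨s, hs⟩ := h1
      rw [hs, Polynomial.mul_comp, Polynomial.pow_comp]
      refine Dvd.dvd.mul_right (pow_dvd_pow_of_dvd ?_ K) _
      refine Dvd.intro_left (Polynomial.C ((ζ ^ k : ℂˣ) : ℂ)) ?_
      rw [Polynomial.sub_comp, Polynomial.X_comp, Polynomial.C_comp, Polynomial.C_mul]
      ring
    · simpa using hne k hk hkT

theorem CyclotomicDatum.orbitSum_sub_mem_lattice (D : CyclotomicDatum b) {K : ℕ}
    {f f₀ : RatFunc ℂ} (i : b.support)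
    (h₀ : localParam x ^ (-K : ℤ) * (f - f₀) ∈ regularAt x)
    (h : ∀ k, 1 ≤ k → k < D.T →
      localParam x ^ (-K : ℤ) * pullback (D.ω⁻¹ ^ k) f ∈ regularAt x) :
    D.orbitSum f i - f₀ ⊗ₜ[ℂ] D.E i ∈ lattice g x K := by
  have hT : D.T = D.T - 1 + 1 := by have := D.T_pos; omega
  rw [orbitSum, hT, Finset.sum_range_succ', pow_zero, Module.End.one_apply, add_sub_assoc,
    ← TensorProduct.sub_tmul]
  refine add_mem (Submodule.sum_mem _ fun k hk => ?_) (tmul_mem_lattice h₀ _)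
  have hk := Finset.mem_range.mp hk
  rw [twist_pow_tmul_E]
  refine tmul_mem_lattice ?_ _
  rw [mul_smul_comm]
  exact Subalgebra.smul_mem _ (h (k + 1) (by omega) (by omega)) _

end Approximation

/-! ### Removing the pole by `exp(-E_i/(t - x))` -/

section LocalGauge

theorem expAd_apply_of_lie_lie_lie_eq_zero {a : Mer g} (ha : a ∈ filtration b 1) {y : Mer g}
    (h : ⁅a, ⁅a, ⁅a, y⁆⁆⁆ = 0) :
    expAd a ha y = y + ⁅a, y⁆ + (2 : ℂ)⁻¹ • ⁅a, ⁅a, y⁆⁆ := by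
  rw [expAd_apply_eq_sum ha (k := 3) (by simpa [pow_succ] using h)]
  simp [Finset.sum_range_succ, pow_succ]

theorem ChevalleyGenerators.lie_E_cartan (C : ChevalleyGenerators b) (i : b.support) (y : H) :
    ⁅C.E i, (y : g)⁆ = -((rootSystem H).root i.1 y • C.E i) := by
  rw [← lie_skew]
  exact congrArg Neg.neg (lie_eq_smul_of_mem_rootSpace (C.E_mem i) y)

/-- The difference of two distinct simple roots is neither zero nor a root. -/
theorem ChevalleyGenerators.lie_E_F_of_ne (C : ChevalleyGenerators b) {i j : b.support}
    (hij : i ≠ j) : ⁅C.E i, C.F j⁆ = 0 := by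
  by_contra h0
  have hmem := lie_mem_genWeightSpace_of_mem_genWeightSpace (C.E_mem i) (C.F_mem j)
  set χ : H → ℂ := (i.1.1 : H → ℂ) + -(j.1.1 : H → ℂ) with hχ
  have hbot : rootSpace H χ ≠ ⊥ := by
    intro hb
    have h1 : ⁅C.E i, C.F j⁆ ∈ rootSpace H χ := hmem
    rw [hb] at h1
    exact h0 h1
  let α : LieModule.Weight ℂ H g := ⟨χ, hbot⟩
  by_cases hα : α.IsZero
  · refine hij (Subtype.ext (Subtype.ext (DFunLike.ext _ _ fun y => ?_)))
    have h1 : χ y = 0 := congrFun hα y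
    rw [hχ, Pi.add_apply, Pi.neg_apply] at h1
    linear_combination h1
  · refine b.sub_notMem_range_root i.2 j.2 ⟨⟨α, by simpa [LieSubalgebra.root] using hα⟩, ?_⟩
    refine LinearMap.ext fun y => ?_
    change χ y = i.1.1 y - j.1.1 y
    rw [hχ, Pi.add_apply, Pi.neg_apply, sub_eq_add_neg]

variable (D : CyclotomicDatum b)

theorem CyclotomicDatum.lie_E_pMinus (i : b.support) :
    ⁅D.E i, D.pMinus⁆ = ((rootSystem H).coroot i.1 : g) := by
  rw [pMinus, lie_sum, Finset.sum_eq_single i, D.lie_E_F]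
  · intro j _ hj
    exact D.toChevalleyGenerators.lie_E_F_of_ne hj.symm
  · intro h
    exact absurd (Finset.mem_univ i) h

theorem ChevalleyGenerators.lie_tmul_E_cartanIncl (C : ChevalleyGenerators b) (i : b.support)
    (f : RatFunc ℂ) (r : regularAt x ⊗[ℂ] H) :
    ⁅f ⊗ₜ[ℂ] C.E i, cartanIncl H (regularIncl H x r)⁆ =
      (-(f * (pairingFun ((rootSystem H).root i.1) r).1)) ⊗ₜ[ℂ] C.E i := by
  unfold pairingFun
  induction r using TensorProduct.induction_on with
  | zero => simp
  | add y z hy hz =>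
    simp only [map_add, lie_add, hy, hz, Subalgebra.coe_add, mul_add, neg_add,
      TensorProduct.add_tmul]
  | tmul f' y =>
    change ⁅f ⊗ₜ[ℂ] C.E i, f'.1 ⊗ₜ[ℂ] (y : g)⁆ = _
    rw [LieAlgebra.ExtendScalars.bracket_tmul, C.lie_E_cartan, LinearMap.lTensor_tmul,
      TensorProduct.rid_tmul, Subalgebra.coe_smul, mul_smul_comm, TensorProduct.neg_tmul,
      TensorProduct.tmul_neg, TensorProduct.tmul_smul, TensorProduct.smul_tmul']

/-- The gauge transformation by `exp (-E_i / (t - x))` removes the pole of a Miura connection with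
residue `α_i^∨` up to a multiple of `⟨α_i, r⟩ E_i / (t - x)`. -/
theorem CyclotomicDatum.local_gauge_eq (i : b.support) (r : regularAt x ⊗[ℂ] H)
    (ha : (-(localParam x)⁻¹) ⊗ₜ[ℂ] D.E i ∈ filtration b 1) :
    expAd ((-(localParam x)⁻¹) ⊗ₜ[ℂ] D.E i) ha (1 ⊗ₜ[ℂ] D.pMinus + cartanIncl H
      ((localParam x)⁻¹ ⊗ₜ[ℂ] (rootSystem H).coroot i.1 + regularIncl H x r)) -
        del ((-(localParam x)⁻¹) ⊗ₜ[ℂ] D.E i) =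
      1 ⊗ₜ[ℂ] D.pMinus + cartanIncl H (regularIncl H x r) +
        ((localParam x)⁻¹ * (pairingFun ((rootSystem H).root i.1) r).1) ⊗ₜ[ℂ] D.E i := by
  set w := (localParam x)⁻¹ with hw
  have hroot : (rootSystem H).root i.1 ((rootSystem H).coroot i.1) = 2 :=
    root_apply_coroot (LieSubalgebra.isNonZero_coe_root i.1)
  have hcor : ∀ f : RatFunc ℂ, ⁅(-w) ⊗ₜ[ℂ] D.E i, f ⊗ₜ[ℂ] ((rootSystem H).coroot i.1 : g)⁆ =
      (2 * (w * f)) ⊗ₜ[ℂ] D.E i := by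
    intro f
    rw [LieAlgebra.ExtendScalars.bracket_tmul, D.toChevalleyGenerators.lie_E_cartan, hroot,
      neg_mul, TensorProduct.tmul_neg, TensorProduct.neg_tmul, neg_neg, TensorProduct.tmul_smul,
      TensorProduct.smul_tmul', RatFunc.smul_eq_C_mul, map_ofNat]
  have hE : ∀ f : RatFunc ℂ, ⁅(-w) ⊗ₜ[ℂ] D.E i, f ⊗ₜ[ℂ] D.E i⁆ = 0 := by
    intro f
    rw [LieAlgebra.ExtendScalars.bracket_tmul, lie_self, TensorProduct.tmul_zero]
  have hp : ⁅(-w) ⊗ₜ[ℂ] D.E i, (1 : RatFunc ℂ) ⊗ₜ[ℂ] D.pMinus⁆ =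
      (-w) ⊗ₜ[ℂ] ((rootSystem H).coroot i.1 : g) := by
    rw [LieAlgebra.ExtendScalars.bracket_tmul, D.lie_E_pMinus, mul_one]
  have hR := D.toChevalleyGenerators.lie_tmul_E_cartanIncl i (-w) r
  have h1 : cartanIncl H (w ⊗ₜ[ℂ] (rootSystem H).coroot i.1 + regularIncl H x r) =
      w ⊗ₜ[ℂ] ((rootSystem H).coroot i.1 : g) + cartanIncl H (regularIncl H x r) := by
    rw [map_add]; rfl
  -- With `a = -w E_i`, the term `[a, p₋₁] = -w α_i^∨` cancels the residue. The multiples of `w²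
  -- E_i` are `2` from `[a, w α_i^∨]`, `-1` from `½[a, [a, p₋₁]]` and `-1` from `-∂a`, with sum
  -- zero.
  rw [h1, map_add, map_add, expAd_apply_of_lie_lie_lie_eq_zero ha (by rw [hp, hcor, hE]),
    expAd_apply_of_lie_lie_lie_eq_zero ha (by rw [hcor, hE, lie_zero]),
    expAd_apply_of_lie_lie_lie_eq_zero ha (by rw [hR, hE, lie_zero]), hp, hcor, hcor, hE, hR, hE,
    del_tmul, map_neg, hw, ddt_inv_localParam, ← hw]
  have h2 : (2 : ℂ)⁻¹ • ((2 * (w * -w)) ⊗ₜ[ℂ] D.E i) = (-(w ^ 2)) ⊗ₜ[ℂ] D.E i := by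
    rw [TensorProduct.smul_tmul', RatFunc.smul_eq_C_mul, ← mul_assoc (RatFunc.C _),
      ← map_ofNat RatFunc.C 2, ← map_mul, inv_mul_cancel₀ two_ne_zero, map_one]
    congr 1
    ring
  rw [h2, neg_neg]
  simp only [smul_zero, add_zero, TensorProduct.neg_tmul, neg_mul, neg_neg]
  have h3 : (2 * (w * w)) ⊗ₜ[ℂ] D.E i = (w ^ 2) ⊗ₜ[ℂ] D.E i + (w ^ 2) ⊗ₜ[ℂ] D.E i := by
    rw [← TensorProduct.add_tmul]
    congr 1
    ring
  rw [h3]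
  abel

end LocalGauge

/-! ### Sufficiency: the cyclotomic gauge transformation -/

section Regularity

variable {D : CyclotomicDatum b}

/-- If a cyclotomic element of `N(𝓜)` takes a cyclotomic connection to one that is regular at `x`,
then its oper is regular at `x`. -/
theorem CyclotomicDatum.OperConnection.isRegularAt_of_gauge (N : D.OperConnection)
    {φ : Mer g ≃ₗ⁅RatFunc ℂ⁆ Mer g} (hφ : φ ∈ D.cyclotomicUnipotentGroup) {X : Mer g}
    (hX : IsLogDeriv φ X)
    (h : φ N.coeff - X ∈ LinearMap.range (regularIncl g x)) :
    CyclotomicOper.IsRegularAt (Quotient.mk D.operSetoid N) x := by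
  obtain ⟨hu, X', hX', hlog⟩ := unipotent_of_mem_unipotentGroup hφ.1
  obtain rfl := hX.unique hlog
  have hN : N.coeff - 1 ⊗ₜ[ℂ] D.pMinus ∈ filtration b 0 := by
    rw [← borel_baseChange_eq, OperConnection.coeff, add_sub_cancel_left]
    exact N.v_mem
  have hNc : D.twistForm N.coeff = N.coeff := by
    rw [OperConnection.coeff, twistForm_add, twistForm_pMinus, N.v_cyclotomic]
  let N' : D.OperConnection :=
    { v := φ N.coeff - X - 1 ⊗ₜ[ℂ] D.pMinus
      v_mem := by
        rw [borel_baseChange_eq]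
        exact gauge_sub_mem (D.pMinus_mem_filtration 1) hu hX' hN
      v_cyclotomic := by
        rw [twistForm_sub, twistForm_sub, twistForm_apply D hφ.2, hNc,
          twistForm_logDeriv D hφ.2 hX, twistForm_pMinus] }
  refine ⟨N', Quotient.sound (Setoid.symm ⟨φ, hφ, X, hX, ?_⟩), ?_⟩
  · change 1 ⊗ₜ[ℂ] D.pMinus + (φ N.coeff - X - 1 ⊗ₜ[ℂ] D.pMinus) = _
    abel
  · exact sub_mem h (tmul_mem_range_regularIncl (one_mem _) _)

theorem isRegularAt_of_root_valueAt_eq_zero (hx : x ≠ 0)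
    (M : D.CyclotomicMiuraOper) (i : b.support) (r : regularAt x ⊗[ℂ] H)
    (hM : M.u = (localParam x)⁻¹ ⊗ₜ[ℂ] (rootSystem H).coroot i.1 + regularIncl H x r)
    (h : (rootSystem H).root i.1 (valueAt x r) = 0) :
    M.underlyingOper.IsRegularAt x := by
  rw [← evalAt_pairingFun, evalAt_eq_zero_iff] at h
  -- The root of unity is `ω⁻¹` because the twist pulls functions back along `t ↦ ω⁻¹ t`; the order
  -- is the one required by `expAd_add_mul_inv_mem`.
  obtain ⟨f, hf₀, hf⟩ := exists_approximation hx D.isPrimitiveRoot_ω.inv (2 * nilpotencyBound b)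
  set a : Mer g := (-(localParam x)⁻¹) ⊗ₜ[ℂ] D.E i with ha_def
  have ha : a ∈ filtration b 1 :=
    tmul_mem_filtration le_rfl _ (D.toChevalleyGenerators.isHomogeneous_E i)
  have hax : a ∈ lattice g x (-1) := by
    refine tmul_mem_lattice ?_ _
    rw [neg_neg, zpow_one, mul_neg, mul_inv_cancel₀ localParam_ne_zero]
    exact neg_mem (one_mem _)
  obtain ⟨c, hc⟩ : ∃ c, a + c = D.orbitSum f i := ⟨D.orbitSum f i - a, by abel⟩
  have hcx : c ∈ lattice g x (2 * nilpotencyBound b) := by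
    have h1 := D.orbitSum_sub_mem_lattice (f₀ := -(localParam x)⁻¹) i
      (by rwa [sub_neg_eq_add]) hf
    rw [← hc, ← ha_def, add_sub_cancel_left] at h1
    exact_mod_cast h1
  have hac : a + c ∈ filtration b 1 := by rw [hc]; exact D.orbitSum_mem_filtration f i
  have hφ : expAd (a + c) hac ∈ D.cyclotomicUnipotentGroup :=
    ⟨mem_unipotentGroup_of_isUnipotent (expAd_isUnipotentOfLevel hac le_rfl hac),
      D.twist_expAd hac (by rw [hc]; exact D.twist_orbitSum f i)⟩
  have hlog : IsLogDeriv (expAd a ha) (del a) := isLogDeriv_expAd ha (by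
    rw [ha_def, del_tmul, LieAlgebra.ExtendScalars.bracket_tmul, lie_self, TensorProduct.tmul_zero])
  -- The orbit sum need not commute with its derivative, so `X` comes from membership in `N(𝓜)` and
  -- not from `isLogDeriv_expAd`.
  obtain ⟨-, X, -, hX⟩ := unipotent_of_mem_unipotentGroup hφ.1
  set R := expAd (a + c) hac * (expAd a ha)⁻¹ with hR
  have hφR : expAd (a + c) hac = R * expAd a ha := by rw [hR, inv_mul_cancel_right]
  have hRlog := hlog.inv.mul hX
  rw [← hR] at hRlog
  have hRreg := isRegular_logDeriv (x := x) hRlog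
    (fun y hy => expAd_add_mul_inv_mem ha hac hax hcx hy)
    (fun y hy => expAd_mul_add_inv_mem ha hac hax hcx hy)
  have hlog' := hlog.mul hRlog
  rw [← hφR] at hlog'
  refine M.toOperConnection.isRegularAt_of_gauge hφ hlog' ?_
  have hA : M.toOperConnection.coeff = 1 ⊗ₜ[ℂ] D.pMinus + cartanIncl H
      ((localParam x)⁻¹ ⊗ₜ[ℂ] (rootSystem H).coroot i.1 + regularIncl H x r) := by
    rw [← hM]; rfl
  have hreg : expAd a ha M.toOperConnection.coeff - del a ∈
      LinearMap.range (regularIncl g x) := by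
    rw [hA, D.local_gauge_eq i r ha]
    exact add_mem (add_mem (tmul_mem_range_regularIncl (one_mem _) _)
      (cartanIncl_regularIncl_mem r)) (tmul_mem_range_regularIncl h _)
  -- Gauging by `exp(a + c)` is gauging by `exp(a)`, which gives a regular connection, and then by
  -- `R`, which preserves regularity and has regular logarithmic derivative.
  have h2 := sub_mem (expAd_add_mul_inv_mem ha hac hax hcx hreg) hRreg
  rw [← hR] at h2
  convert h2 using 1
  rw [hφR, aut_mul_apply, map_sub]
  abel

end Regularity

end Oper

end

theorem proposition4 {g : Type*} [LieRing g] [LieAlgebra ℂ g] [FiniteDimensional ℂ g]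
    [LieAlgebra.IsSemisimple ℂ g] {H : LieSubalgebra ℂ g} [H.IsCartanSubalgebra]
    {b : (LieAlgebra.IsKilling.rootSystem H).Base}
    (D : Oper.CyclotomicDatum b) (x : ℂ) (hx : x ≠ 0)
    (M : D.CyclotomicMiuraOper) (i : b.support)
    (r : Oper.regularAt x ⊗[ℂ] H)
    (hM : M.u = (RatFunc.X - RatFunc.C x)⁻¹ ⊗ₜ[ℂ] (LieAlgebra.IsKilling.rootSystem H).coroot i.1 +
      Oper.regularIncl H x r) :
    M.underlyingOper.IsRegularAt x ↔
      (LieAlgebra.IsKilling.rootSystem H).root i.1 (Oper.valueAt x r) = 0 :=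
  ⟨Oper.root_valueAt_eq_zero_of_isRegularAt D M i r hM,
    Oper.isRegularAt_of_root_valueAt_eq_zero hx M i r hM⟩
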